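/- Theorem 1.3. Let $r \geq 6$ be an integer and let $F(x,y) \in \mathbb{Z}[x,y]$ be a diagonalizable binary form of degree $r$, i.e. $F(x,y) = (\alpha x + \beta y)^r - (\gamma x + \delta y)^r$ for some complex constants $\alpha,\beta,\gamma,\delta$ with $\alpha\delta - \beta\gamma \neq 0$. Then $(\alpha x+\beta y)(\gamma x+\delta y) = \chi\,(Ax^2+Bxy+Cy^2)$ for some integers $A,B,C$ and a constant $\chi$; put $D = B^2-4AC$ (the triple $(A,B,C)$ is unique up to a nonzero rational factor, so the sign of $D$ depends only on $F$). Let $\Delta$ be the discriminant of $F$, that is, $\Delta = \prod_{i<j}(a_ib_j-a_jb_i)^2$ for any factorization $F = \prod_{i=1}^r (a_i x+b_i y)$ over $\mathbb{C}$. Let $h$ be a positive integer, let $$\Delta' = \frac{|\Delta|}{2^{r^2-r}\, r^r\, h^{2r-2}},$$ and let $N_F(h)$ be the number of pairs $(x,y) \in \mathbb{Z}^2$ with $\gcd(x,y)=1$ and $0 < |F(x,y)| \leq h$, where $(x,y)$ and $(-x,-y)$ are counted as one. Call $F$ definite if it takes only positive or only negative values on $\mathbb{R}^2\setminus\{(0,0)\}$,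 and indefinite if it takes both positive and negative values on $\mathbb{R}^2$. Suppose that $$\Delta' \geq r^{\frac{13r^2(r-1)}{r^2-5r-2}}\, h^{\frac{4(r-1)(r^2-r+2)}{r^2-5r-2}}.$$ Then $N_F(h)$ is finite and $$N_F(h) \leq \begin{cases} 2r+1 & \text{if } D<0,\\ 5 & \text{if } D>0,\ r \text{ is even and } F \text{ is indefinite},\\ 3 & \text{if } D>0,\ r \text{ is odd and } F \text{ is indefinite},\\ 1 & \text{if } F \text{ is definite}.\end{cases}$$ -/

import Mathlib

namespace DiagForm

open MvPolynomial

/-- `F(x, y) = (α x + β y)^r - (γ x + δ y)^r` as polynomials over `ℂ`, with `α δ - β γ ≠ 0`. In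
particular `F` is then a binary form of degree `r`. -/
def IsDiagonalization (r : ℕ) (F : MvPolynomial (Fin 2) ℤ) (α β γ δ : ℂ) : Prop :=
  α * δ - β * γ ≠ 0 ∧
    map (Int.castRingHom ℂ) F = (C α * X 0 + C β * X 1) ^ r - (C γ * X 0 + C δ * X 1) ^ r

/-- `F ∈ ℤ[x, y]` is a diagonalizable binary form of degree `r`. -/
def IsDiagonalizable (r : ℕ) (F : MvPolynomial (Fin 2) ℤ) : Prop :=
  ∃ α β γ δ : ℂ, IsDiagonalization r F α β γ δ

/-- `D = B² - 4AC` for integers `A, B, C` with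
`(α x + β y) (γ x + δ y) = χ (A x² + B x y + C y²)`, where `F = (α x + β y)^r - (γ x + δ y)^r`.
The triple `(A, B, C)` is determined by `F` only up to a common rational factor, so it is the sign
of `D` that is an invariant of `F`. -/
def IsQuadraticDiscr (r : ℕ) (F : MvPolynomial (Fin 2) ℤ) (D : ℤ) : Prop :=
  ∃ α β γ δ χ : ℂ, ∃ a b c : ℤ, IsDiagonalization r F α β γ δ ∧
    ((C α * X 0 + C β * X 1) * (C γ * X 0 + C δ * X 1) : MvPolynomial (Fin 2) ℂ) =
      C χ * (C (a : ℂ) * X 0 ^ 2 + C (b : ℂ) * (X 0 * X 1) + C (c : ℂ) * X 1 ^ 2) ∧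
    D = b ^ 2 - 4 * a * c

/-- `Δ` is the discriminant of the binary form `F` of degree `r`: writing
`F = ∏ᵢ (aᵢ x + bᵢ y)` with complex linear forms, `Δ = ∏_{i < j} (aᵢ bⱼ - aⱼ bᵢ)²`. The value does
not depend on the factorization. -/
def IsDiscriminant (r : ℕ) (F : MvPolynomial (Fin 2) ℤ) (Δ : ℂ) : Prop :=
  ∃ a b : Fin r → ℂ, map (Int.castRingHom ℂ) F = ∏ i, (C (a i) * X 0 + C (b i) * X 1) ∧
    Δ = ∏ i, ∏ j ∈ Finset.Ioi i, (a i * b j - a j * b i) ^ 2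

/-- `Δ' = |Δ| / (2^{r² - r} r^r h^{2r - 2})`. -/
noncomputable def deltaPrime (r : ℕ) (Δ : ℂ) (h : ℤ) : ℝ :=
  ‖Δ‖ / ((2 : ℝ) ^ (r ^ 2 - r) * (r : ℝ) ^ r * (h : ℝ) ^ (2 * r - 2))

/-- The primitive integer solutions of `0 < |F(x, y)| ≤ h`. -/
def primitiveSolutions (F : MvPolynomial (Fin 2) ℤ) (h : ℤ) : Set (ℤ × ℤ) :=
  {p | Int.gcd p.1 p.2 = 1 ∧ 0 < |eval ![p.1, p.2] F| ∧ |eval ![p.1, p.2] F| ≤ h}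

/-- `N_F(h)`: the number of primitive solutions of `0 < |F(x, y)| ≤ h`, where `(x, y)` and
`(-x, -y)` count as one solution (`s(p, -p)` is the unordered pair). The count takes values in
`ℕ∞`, so an upper bound for it contains the finiteness of the set of solutions. -/
noncomputable def numSolutions (F : MvPolynomial (Fin 2) ℤ) (h : ℤ) : ℕ∞ :=
  ((fun p : ℤ × ℤ => s(p, -p)) '' primitiveSolutions F h).encard

/-- `F` takes only positive, or only negative, values at the nonzero points of `ℝ²`. -/
def IsDefinite (F : MvPolynomial (Fin 2) ℤ) : Prop :=
  (∀ x y : ℝ, (x, y) ≠ (0, 0) → 0 < aeval ![x, y] F) ∨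
    (∀ x y : ℝ, (x, y) ≠ (0, 0) → aeval ![x, y] F < 0)

/-- `F` takes both positive and negative values on `ℝ²`. -/
def IsIndefinite (F : MvPolynomial (Fin 2) ℤ) : Prop :=
  (∃ x y : ℝ, 0 < aeval ![x, y] F) ∧ (∃ x y : ℝ, aeval ![x, y] F < 0)

/-- The coefficients of a diagonalization are tied to integers. -/
theorem IsDiagonalization.exists_coeff {r : ℕ} {F : MvPolynomial (Fin 2) ℤ} {α β γ δ : ℂ}
    (hF : IsDiagonalization r F α β γ δ) (k : ℕ) (hk : k ≤ r) :
    ∃ m : ℤ, (m : ℂ) = (r.choose k : ℂ) * (α ^ (r - k) * β ^ k - γ ^ (r - k) * δ ^ k) := by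
  have key : ∀ a b : ℂ, ((Polynomial.C a + Polynomial.C b * Polynomial.X) ^ r).coeff k =
      (r.choose k : ℂ) * (a ^ (r - k) * b ^ k) := by
    intro a b
    rw [add_comm, add_pow, Polynomial.finsetSum_coeff, Finset.sum_eq_single k]
    · rw [mul_pow, ← Polynomial.C_pow, ← Polynomial.C_pow, ← Polynomial.C_eq_natCast,
        Polynomial.coeff_mul_C, Polynomial.coeff_mul_C, Polynomial.coeff_C_mul,
        Polynomial.coeff_X_pow]
      simp
      ring
    · intro i _ hik
      rw [mul_pow, ← Polynomial.C_pow, ← Polynomial.C_pow, ← Polynomial.C_eq_natCast,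
        Polynomial.coeff_mul_C, Polynomial.coeff_mul_C, Polynomial.coeff_C_mul,
        Polynomial.coeff_X_pow]
      simp [Ne.symm hik]
    · intro hn
      exact absurd (Finset.mem_range.2 (by omega)) hn
  refine ⟨(aeval ![(1 : Polynomial ℤ), Polynomial.X] F).coeff k, ?_⟩
  have h1 := congrArg (aeval ![(1 : Polynomial ℂ), Polynomial.X]) hF.2
  have h2 : aeval ![(1 : Polynomial ℂ), Polynomial.X] (map (Int.castRingHom ℂ) F) =
      (aeval ![(1 : Polynomial ℤ), Polynomial.X] F).map (Int.castRingHom ℂ) := by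
    have : (aeval ![(1 : Polynomial ℂ), Polynomial.X]).toRingHom.comp
        (map (σ := Fin 2) (Int.castRingHom ℂ)) =
        (Polynomial.mapRingHom (Int.castRingHom ℂ)).comp
          (aeval ![(1 : Polynomial ℤ), Polynomial.X]).toRingHom := by
      apply MvPolynomial.ringHom_ext
      · intro n
        simp
      · intro i
        fin_cases i <;> simp
    exact congrArg (fun f => f F) this
  rw [h2] at h1
  have h3 := congrArg (fun p => Polynomial.coeff p k) h1
  simp only [Polynomial.coeff_map, eq_intCast] at h3
  rw [h3]
  simp only [map_sub, map_pow, map_add, map_mul, aeval_C, aeval_X, Matrix.cons_val_zero,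
    Matrix.cons_val_one, mul_one, Polynomial.algebraMap_eq, Polynomial.coeff_sub]
  rw [key, key]
  ring

/-- A diagonalizable form of degree at least three has an associated `D`. -/
theorem IsDiagonalizable.exists_quadraticDiscr {r : ℕ} (hr : 3 ≤ r)
    {F : MvPolynomial (Fin 2) ℤ} (hF : IsDiagonalizable r F) : ∃ D, IsQuadraticDiscr r F D := by
  obtain ⟨α, β, γ, δ, hd⟩ := hF
  have hj := hd.1
  suffices H : ∃ χ : ℂ, ∃ a b c : ℤ, α * γ = χ * a ∧ α * δ + β * γ = χ * b ∧ β * δ = χ * c by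
    obtain ⟨χ, a, b, c, h1, h2, h3⟩ := H
    refine ⟨_, α, β, γ, δ, χ, a, b, c, hd, ?_, rfl⟩
    have e1 := congrArg (C (σ := Fin 2)) h1
    have e2 := congrArg (C (σ := Fin 2)) h2
    have e3 := congrArg (C (σ := Fin 2)) h3
    simp only [map_mul, map_add] at e1 e2 e3
    linear_combination X 0 ^ 2 * e1 + X 0 * X 1 * e2 + X 1 ^ 2 * e3
  obtain ⟨m0, h0⟩ := hd.exists_coeff 0 (by omega)
  obtain ⟨m1, h1⟩ := hd.exists_coeff 1 (by omega)
  obtain ⟨m2, h2⟩ := hd.exists_coeff 2 (by omega)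
  obtain ⟨m3, h3⟩ := hd.exists_coeff 3 (by omega)
  obtain ⟨n, rfl⟩ : ∃ n, r = n + 3 := ⟨r - 3, by omega⟩
  have hn2 : ((n + 3).choose 2 : ℂ) ≠ 0 :=
    Nat.cast_ne_zero.2 (Nat.choose_pos (by omega)).ne'
  have hn3 : ((n + 3).choose 3 : ℂ) ≠ 0 :=
    Nat.cast_ne_zero.2 (Nat.choose_pos (by omega)).ne'
  have hn1 : ((n + 3 : ℕ) : ℂ) ≠ 0 := Nat.cast_ne_zero.2 (by omega)
  rw [show n + 3 - 0 = n + 3 by omega, Nat.choose_zero_right] at h0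
  rw [show n + 3 - 1 = n + 2 by omega, Nat.choose_one_right] at h1
  rw [show n + 3 - 2 = n + 1 by omega] at h2
  rw [show n + 3 - 3 = n by omega] at h3
  by_cases hα : α = 0
  · subst hα
    have hγ : γ ≠ 0 := fun h => hj (by simp [h])
    refine ⟨-β / ((n + 3 : ℕ) * γ ^ (n + 2)), 0, (n + 3 : ℕ) * m0, m1, by simp, ?_, ?_⟩
    · push_cast at h0 hn1 ⊢
      rw [h0]
      field_simp
      simp
      ring
    · rw [h1]
      push_cast at hn1 ⊢
      field_simp
      simp
      ring
  by_cases hγ : γ = 0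
  · subst hγ
    refine ⟨δ / ((n + 3 : ℕ) * α ^ (n + 2)), 0, (n + 3 : ℕ) * m0, m1, by simp, ?_, ?_⟩
    · push_cast at h0 hn1 ⊢
      rw [h0]
      field_simp
      simp
      ring
    · rw [h1]
      push_cast at hn1 ⊢
      field_simp
      simp
      ring
  · set N1 := (n + 3).choose 2 with hN1
    set N2 := (n + 3).choose 3 with hN2
    set N0 := n + 3 with hN0
    have hJ : (α * δ - β * γ) ^ 2 ≠ 0 := pow_ne_zero 2 hj
    have hw : -(N0 * N0 * N1 * N1 * N2 : ℂ) * (α ^ n * γ ^ n * (α * δ - β * γ) ^ 2) ≠ 0 := by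
      refine mul_ne_zero (neg_ne_zero.2 ?_) (mul_ne_zero (mul_ne_zero ?_ ?_) hJ)
      · exact mul_ne_zero (mul_ne_zero (mul_ne_zero (mul_ne_zero hn1 hn1) hn2) hn2) hn3
      · exact pow_ne_zero _ hα
      · exact pow_ne_zero _ hγ
    refine ⟨(-(N0 * N0 * N1 * N1 * N2 : ℂ) * (α ^ n * γ ^ n * (α * δ - β * γ) ^ 2))⁻¹,
      N0 * N0 * N1 * N2 * m0 * m2 - N1 * N1 * N2 * m1 * m1,
      N0 * N0 * N1 * N1 * m0 * m3 - N0 * N1 * N2 * m1 * m2,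
      N0 * N1 * N1 * m1 * m3 - N0 * N0 * N2 * m2 * m2, ?_, ?_, ?_⟩
    · rw [eq_inv_mul_iff_mul_eq₀ hw]
      push_cast
      rw [h0, h1, h2, hN0]
      push_cast
      ring
    · rw [eq_inv_mul_iff_mul_eq₀ hw]
      push_cast
      rw [h0, h1, h2, h3, hN0]
      push_cast
      ring
    · rw [eq_inv_mul_iff_mul_eq₀ hw]
      push_cast
      rw [h1, h2, h3, hN0]
      push_cast
      ring

/-- A diagonalizable form splits into linear forms over `ℂ`, so it has a discriminant. -/
theorem IsDiagonalizable.exists_discriminant {r : ℕ} (hr : 0 < r)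
    {F : MvPolynomial (Fin 2) ℤ} (hF : IsDiagonalizable r F) : ∃ Δ, IsDiscriminant r F Δ := by
  obtain ⟨α, β, γ, δ, -, hd⟩ := hF
  obtain ⟨ζ, hζ⟩ : ∃ ζ : ℂ, IsPrimitiveRoot ζ r := ⟨_, Complex.isPrimitiveRoot_exp r hr.ne'⟩
  have hC : IsPrimitiveRoot (C ζ : MvPolynomial (Fin 2) ℂ) r :=
    hζ.map_of_injective (C_injective _ _)
  refine ⟨_, fun k => α - ζ ^ (k : ℕ) * γ, fun k => β - ζ ^ (k : ℕ) * δ, ?_, rfl⟩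
  have himg : (Finset.range r).image (fun k => (C ζ : MvPolynomial (Fin 2) ℂ) ^ k) =
      Polynomial.nthRootsFinset r (1 : MvPolynomial (Fin 2) ℂ) := by
    apply Finset.eq_of_subset_of_card_le
    · intro x hx
      obtain ⟨k, -, rfl⟩ := Finset.mem_image.1 hx
      rw [Polynomial.mem_nthRootsFinset hr, ← pow_mul, mul_comm, pow_mul, hC.pow_eq_one, one_pow]
    · rw [hC.card_nthRootsFinset, Finset.card_image_of_injOn, Finset.card_range]
      intro i hi j hj hij
      exact hC.pow_inj (by simpa using hi) (by simpa using hj) hij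
  rw [hd, hC.pow_sub_pow_eq_prod_sub_mul _ _ hr, ← himg, Finset.prod_image, Finset.prod_range]
  · refine Finset.prod_congr rfl fun k _ => ?_
    simp only [map_sub, map_mul, map_pow]
    ring
  · intro i hi j hj hij
    exact hC.pow_inj (by simpa using hi) (by simpa using hj) hij

end DiagForm

namespace DiagForm

/-! ### Padé approximants to `x ^ ν` from Lagrange interpolation. -/

section Pade
open Finset Polynomial

/-! Write F = ξ^r - η^r with linear forms ξ, η of determinant j, and W = (|j|/2)^r. Since |Δ| = r^r
|j|^(r(r-1)) (`IsDiagonalization.norm_discriminant`), the hypothesis forces W to be large; only its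
consequence r^13 h^6 ≤ W is used (`pow_le_of_deltaPrime`).

For essentially different primitive points p, q the number ξ(p)η(q) - ξ(q)η(p) is j times a nonzero
integer. So at most one solution is small, meaning 2|ξ|^(2r) < W (`eq_or_eq_neg_of_small`). For
every other solution η/ξ = ω(1 + w)^(1/r) with ω^r = 1 and |w| ≤ h/|ξ|^r. For two such solutions
with the same ω the same inequality becomes a gap principle: the larger |ξ|^r is at least about the
(r-1)-st power of the smaller (`IsRelated.gap`).

Three solutions cannot share one ω (`false_of_three_related`). This is the Thue-Siegel method with
Padé approximants P_n/Q_n to x^(1/r) (`exists_integral_pade`). If p₂, p₃ are the two largest,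
substituting 1 + w₂ into P_n and Q_n and comparing with η/ξ at p₃ gives the difference of two
conjugate elements of a quadratic order, up to a known factor. If nonzero, it is bounded below
(`norm_det_le`), while the Padé remainder makes it small. So |ξ(p₃)|^r avoids an interval depending
on n. These intervals overlap as n grows and the gap principle puts |ξ(p₃)|^r beyond the first, so
it would exceed every bound (`false_of_windows`). Nonvanishing holds for one of any two consecutive
n (`exists_pade_det`).

There are r choices for ω, whence 2r + 1. For D > 0 all relevant ratios are real, so only ±ω occur,
and only ω if r is odd, whence 5 and 3. A definite F has D > 0 and even r, and its two r-th powers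
do not cancel, so |ξ|^r and |η|^r are at most h for every solution and the determinant inequality
leaves a single one. -/

theorem prime_pow_dvd_factorial_le {p k m : ℕ} (hp : p.Prime) (h : p ^ k ∣ m.factorial) :
    k ≤ m := by
  have := Fact.mk hp
  have h1 := (padicValNat_dvd_iff_le (Nat.factorial_ne_zero m)).1 h
  have h2 := sub_one_mul_padicValNat_factorial (p := p) m
  have h3 : 1 ≤ p - 1 := by have := hp.two_le; omega
  nlinarith [Nat.sub_le m (p.digits m).sum]

/-- A product of `m` terms of an arithmetic progression of difference `r` becomes divisible by
`m!` after multiplication by `r ^ m`. -/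
theorem factorial_dvd_pow_mul_prod (r a m : ℕ) :
    m.factorial ∣ r ^ m * ∏ i ∈ range m, (a + r * i) := by
  rw [Nat.dvd_iff_prime_pow_dvd_dvd]
  intro p k hp hk
  -- If p divides r, then r^m alone absorbs p^k, since k ≤ m. Otherwise r has an inverse s modulo
  -- p^k, and s^m turns the progression into consecutive integers starting at sa.
  by_cases hpr : p ∣ r
  · exact ((pow_dvd_pow p (prime_pow_dvd_factorial_le hp hk)).trans
      (pow_dvd_pow_of_dvd hpr m)).mul_right _
  · have hco : Nat.Coprime r (p ^ k) :=
      Nat.Coprime.pow_right _ ((Nat.Prime.coprime_iff_not_dvd hp).2 hpr).symm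
    rcases Nat.eq_zero_or_pos k with rfl | hk0
    · simp
    obtain ⟨s, -, hs⟩ := Nat.exists_mul_mod_eq_one_of_coprime hco (Nat.one_lt_pow hk0.ne' hp.one_lt)
    have hs' : ((r : ZMod (p ^ k)) * s) = 1 := by
      have h1 : r * s ≡ 1 [MOD p ^ k] := by
        rw [Nat.ModEq, hs, Nat.mod_eq_of_lt (Nat.one_lt_pow hk0.ne' hp.one_lt)]
      exact_mod_cast (ZMod.natCast_eq_natCast_iff _ _ _).2 h1
    have h2 : (((s * a).ascFactorial m : ℕ) : ZMod (p ^ k)) = 0 :=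
      (ZMod.natCast_eq_zero_iff _ _).2 (hk.trans (Nat.factorial_dvd_ascFactorial _ _))
    have h3 : (s : ZMod (p ^ k)) ^ m * ∏ i ∈ range m, ((a : ZMod (p ^ k)) + r * i) = 0 := by
      have h4 : (s : ZMod (p ^ k)) ^ m = ∏ _i ∈ range m, (s : ZMod (p ^ k)) := by simp
      rw [← h2, Nat.ascFactorial_eq_prod_range, Nat.cast_prod, h4, ← prod_mul_distrib]
      refine prod_congr rfl fun i _ => ?_
      push_cast
      linear_combination (i : ZMod (p ^ k)) * hs'
    rw [← ZMod.natCast_eq_zero_iff]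
    have h4 : ((r : ZMod (p ^ k)) * s) ^ m * ∏ i ∈ range m, ((a : ZMod (p ^ k)) + r * i) = 0 := by
      rw [mul_pow, mul_assoc, h3, mul_zero]
    rw [hs', one_pow, one_mul] at h4
    push_cast
    rw [h4, mul_zero]

theorem ringChoose_eq_prod_div (s : ℚ) (m : ℕ) :
    Ring.choose s m = (∏ j ∈ range m, (s - j)) / m.factorial := by
  have h : ∀ m : ℕ, (descPochhammer ℤ m).smeval s = ∏ j ∈ range m, (s - j) := by
    intro m
    induction m with
    | zero => simp
    | succ m ih =>
      rw [descPochhammer_succ_right, smeval_mul, ih, prod_range_succ]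
      simp [smeval_sub, smeval_natCast]
  rw [Ring.choose_eq_smul, h, smul_eq_mul, div_eq_inv_mul]

/-- The coefficients of the diagonal Padé approximants to `x ^ ν` in homogeneous form; the degree
of the approximant is `k + m`. -/
noncomputable def padeCoeff (ν : ℚ) (k m : ℕ) : ℚ :=
  (∏ i ∈ range m, (k + 1 + i - ν)) / m.factorial * ((∏ i ∈ range k, (m + 1 + i + ν)) / k.factorial)

theorem prod_erase_sub (k m : ℕ) :
    ∏ j ∈ (range (k + m + 1)).erase k, ((k : ℚ) - j) =
      (-1) ^ m * k.factorial * m.factorial := by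
  have h1 : ∏ j ∈ (range (k + m + 1)).erase k, ((k : ℚ) - j) =
      ∏ j ∈ range (k + 1 + m), (if j = k then 1 else (k : ℚ) - j) := by
    rw [← prod_erase (range (k + 1 + m)) (a := k) (by simp), show k + m + 1 = k + 1 + m by ring]
    refine prod_congr rfl fun j hj => ?_
    rw [if_neg (ne_of_mem_erase hj)]
  rw [h1, prod_range_add, prod_range_succ, ← prod_range_reflect]
  have h2 : ∀ j ∈ range k, (if k - 1 - j = k then (1 : ℚ) else (k : ℚ) - ((k - 1 - j : ℕ) : ℚ)) =
      ((j + 1 : ℕ) : ℚ) := by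
    intro j hj
    have hj := mem_range.1 hj
    rw [if_neg (by omega), show k - 1 - j = k - (1 + j) by omega, Nat.cast_sub (by omega)]
    push_cast
    ring
  have h3 : ∀ j ∈ range m, (if k + 1 + j = k then (1 : ℚ) else (k : ℚ) - ((k + 1 + j : ℕ) : ℚ)) =
      (-1) * ((j + 1 : ℕ) : ℚ) := by
    intro j hj
    rw [if_neg (by omega)]
    push_cast
    ring
  rw [prod_congr rfl h2, prod_congr rfl h3, prod_mul_distrib, ← Nat.cast_prod, ← Nat.cast_prod,
    prod_range_add_one_eq_factorial, prod_range_add_one_eq_factorial]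
  simp
  ring

/-- With `prod_erase_sub` this evaluates the Lagrange denominators on the nodes 0, …, n and ν, …, ν
+ n. The factor `t` is the term j = k. -/
theorem prod_shift (t : ℚ) (k m : ℕ) :
    ∏ j ∈ range (k + m + 1), (t + k - j) =
      t * (∏ i ∈ range k, (1 + i + t)) * ((-1) ^ m * ∏ i ∈ range m, (1 + i - t)) := by
  rw [show k + m + 1 = k + 1 + m by ring, prod_range_add, prod_range_succ, ← prod_range_reflect]
  have h2 : ∀ j ∈ range k, (t + (k : ℚ) - ((k - 1 - j : ℕ) : ℚ)) = 1 + j + t := by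
    intro j hj
    have hj := mem_range.1 hj
    rw [show k - 1 - j = k - (1 + j) by omega, Nat.cast_sub (by omega)]
    push_cast
    ring
  have h3 : ∀ j ∈ range m, (t + (k : ℚ) - ((k + 1 + j : ℕ) : ℚ)) = (-1) * (1 + j - t) := by
    intro j hj
    push_cast
    ring
  rw [prod_congr rfl h2, prod_congr rfl h3, prod_mul_distrib, prod_const, card_range,
    add_sub_cancel_right]
  ring

theorem prod_one_add_sub_ne_zero {ν : ℚ} (h1 : ν < 1) (m : ℕ) :
    ∏ i ∈ range m, (1 + (i : ℚ) - ν) ≠ 0 :=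
  prod_ne_zero_iff.2 fun i _ => by
    have : (0 : ℚ) ≤ i := by positivity
    linarith

theorem prod_one_add_add_ne_zero {ν : ℚ} (h0 : 0 < ν) (m : ℕ) :
    ∏ i ∈ range m, (1 + (i : ℚ) + ν) ≠ 0 :=
  prod_ne_zero_iff.2 fun i _ => by positivity

/-- The numerator depends only on k + m, so for fixed degree the coefficients are proportional to
Lagrange weights. -/
theorem padeCoeff_eq {ν : ℚ} (h0 : 0 < ν) (h1 : ν < 1) (k m : ℕ) :
    padeCoeff ν k m = ((∏ i ∈ range (k + m), (1 + (i : ℚ) - ν)) *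
      ∏ i ∈ range (k + m), (1 + (i : ℚ) + ν)) /
      (k.factorial * m.factorial * (∏ i ∈ range k, (1 + (i : ℚ) - ν)) *
        ∏ i ∈ range m, (1 + (i : ℚ) + ν)) := by
  have e1 : ∏ i ∈ range (k + m), (1 + (i : ℚ) - ν) =
      (∏ i ∈ range k, (1 + (i : ℚ) - ν)) * ∏ i ∈ range m, (k + 1 + i - ν) := by
    rw [prod_range_add]
    congr 1
    exact prod_congr rfl fun i _ => by push_cast; ring
  have e2 : ∏ i ∈ range (k + m), (1 + (i : ℚ) + ν) =
      (∏ i ∈ range m, (1 + (i : ℚ) + ν)) * ∏ i ∈ range k, (m + 1 + i + ν) := by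
    rw [add_comm k m, prod_range_add]
    congr 1
    exact prod_congr rfl fun i _ => by push_cast; ring
  have n1 := prod_one_add_sub_ne_zero h1 k
  have n2 := prod_one_add_add_ne_zero h0 m
  rw [e1, e2, padeCoeff]
  field_simp

/-- Up to the factor K, the left side is the divided difference of `f` on the 2n + 2 nodes 0, …, n,
ν, …, ν + n. It is the coefficient of degree 2n + 1 of `f`, hence zero. -/
theorem sum_padeCoeff_mul_eval {ν : ℚ} (h0 : 0 < ν) (h1 : ν < 1) (n : ℕ) {f : ℚ[X]}
    (hf : f.natDegree ≤ 2 * n) :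
    ∑ k ∈ range (n + 1), padeCoeff ν k (n - k) * f.eval (k : ℚ) -
      ∑ k ∈ range (n + 1), padeCoeff ν (n - k) k * f.eval (ν + k) = 0 := by
  set s : Finset (ℕ ⊕ ℕ) := (range (n + 1)).disjSum (range (n + 1)) with hs
  set v : ℕ ⊕ ℕ → ℚ := Sum.elim (fun k => (k : ℚ)) (fun k => ν + k) with hv
  have hne : ∀ a b : ℕ, (a : ℚ) ≠ ν + b := by
    intro a b hab
    rcases le_or_gt a b with h | h
    · have : (a : ℚ) ≤ b := by exact_mod_cast h
      linarith
    · have : (b : ℚ) + 1 ≤ a := by exact_mod_cast h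
      linarith
  have hinj : Set.InjOn v s := by
    rintro (a | a) - (b | b) - hab
    · simpa [hv] using hab
    · exact absurd hab (hne a b)
    · exact absurd hab.symm (hne b a)
    · simpa [hv] using hab
  have hcard : s.card = 2 * n + 2 := by
    rw [hs, card_disjSum, card_range]; ring
  have hdeg : f.degree < (s.card : WithBot ℕ) := by
    refine degree_le_natDegree.trans_lt ?_
    rw [hcard]
    exact_mod_cast (by omega : f.natDegree < 2 * n + 2)
  have key := Lagrange.coeff_eq_sum hinj hdeg
  rw [coeff_eq_zero_of_natDegree_lt (by rw [hcard]; omega), hs, sum_disjSum] at key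
  set K : ℚ := -ν * ((∏ i ∈ range n, (1 + (i : ℚ) - ν)) * ∏ i ∈ range n, (1 + (i : ℚ) + ν)) with hK
  have el : ∀ k ∈ range (n + 1), padeCoeff ν k (n - k) * f.eval (k : ℚ) =
      K * (f.eval (v (Sum.inl k)) / ∏ j ∈ s.erase (Sum.inl k), (v (Sum.inl k) - v j)) := by
    intro k hk
    obtain ⟨m, rfl⟩ := Nat.exists_eq_add_of_le (Nat.lt_succ_iff.1 (mem_range.1 hk))
    have he : s.erase (Sum.inl k) = ((range (k + m + 1)).erase k).disjSum (range (k + m + 1)) := by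
      ext x
      rcases x with x | x <;> simp [hs]
    have e2 : ∏ j ∈ range (k + m + 1), (v (Sum.inl k) - v (Sum.inr j)) =
        ∏ j ∈ range (k + m + 1), (-ν + k - j) :=
      prod_congr rfl fun j _ => by simp [hv]; ring
    have e1 : ∏ j ∈ (range (k + m + 1)).erase k, (v (Sum.inl k) - v (Sum.inl j)) =
        ∏ j ∈ (range (k + m + 1)).erase k, ((k : ℚ) - j) := rfl
    rw [he, prod_disjSum, e1, e2, prod_erase_sub, prod_shift, Nat.add_sub_cancel_left,
      padeCoeff_eq h0 h1, hK]
    have n1 := prod_one_add_sub_ne_zero h1 k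
    have n2 := prod_one_add_add_ne_zero h0 m
    have n3 : ((-1 : ℚ) ^ m) ^ 2 = 1 := by rw [← pow_mul, mul_comm, pow_mul]; simp
    simp only [sub_neg_eq_add, ← sub_eq_add_neg, hv, Sum.elim_inl]
    field_simp
    rw [n3, mul_one]
  have er : ∀ k ∈ range (n + 1), padeCoeff ν (n - k) k * f.eval (ν + k) =
      -(K * (f.eval (v (Sum.inr k)) / ∏ j ∈ s.erase (Sum.inr k), (v (Sum.inr k) - v j))) := by
    intro k hk
    obtain ⟨m, rfl⟩ := Nat.exists_eq_add_of_le (Nat.lt_succ_iff.1 (mem_range.1 hk))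
    have he : s.erase (Sum.inr k) = (range (k + m + 1)).disjSum ((range (k + m + 1)).erase k) := by
      ext x
      rcases x with x | x <;> simp [hs]
    have e2 : ∏ j ∈ range (k + m + 1), (v (Sum.inr k) - v (Sum.inl j)) =
        ∏ j ∈ range (k + m + 1), (ν + k - j) := rfl
    have e1 : ∏ j ∈ (range (k + m + 1)).erase k, (v (Sum.inr k) - v (Sum.inr j)) =
        ∏ j ∈ (range (k + m + 1)).erase k, ((k : ℚ) - j) :=
      prod_congr rfl fun j _ => by simp [hv]
    rw [he, prod_disjSum, e1, e2, prod_erase_sub, prod_shift, Nat.add_sub_cancel_left,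
      padeCoeff_eq h0 h1, hK, add_comm m k]
    have n1 := prod_one_add_sub_ne_zero h1 m
    have n2 := prod_one_add_add_ne_zero h0 k
    have n3 : ((-1 : ℚ) ^ m) ^ 2 = 1 := by rw [← pow_mul, mul_comm, pow_mul]; simp
    simp only [hv, Sum.elim_inr]
    field_simp
    rw [n3, mul_one]
  rw [sum_congr rfl el, sum_congr rfl er, sum_neg_distrib, ← mul_sum, ← mul_sum, sub_neg_eq_add,
    ← mul_add, ← key, mul_zero]

end Pade

/-! ### Size, integrality, remainder and independence of the Padé approximants. -/

section PadeBounds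
open Finset Polynomial

theorem padeCoeff_nonneg {ν : ℚ} (h0 : 0 < ν) (h1 : ν < 1) (k m : ℕ) : 0 ≤ padeCoeff ν k m := by
  unfold padeCoeff
  have : 0 ≤ ∏ i ∈ range m, ((k : ℚ) + 1 + i - ν) :=
    prod_nonneg fun i _ => by
      have : (0 : ℚ) ≤ k + i := by positivity
      linarith
  positivity

theorem prod_range_add_cast (k m : ℕ) :
    ∏ i ∈ range m, ((k : ℚ) + 1 + i) = m.factorial * (k + m).choose m := by
  rw [← Nat.cast_mul, ← Nat.ascFactorial_eq_factorial_mul_choose, Nat.ascFactorial_eq_prod_range]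
  push_cast
  rfl

/-- The two factors are the binomials of n - ν over m and of n + ν over k, where n = k + m. They are
compared with ν = 0 and ν = 1 respectively. -/
theorem padeCoeff_le {ν : ℚ} (h0 : 0 < ν) (h1 : ν < 1) (k m : ℕ) :
    padeCoeff ν k m ≤ (k + m).choose m * 2 ^ (k + m + 1) := by
  have b1 : (∏ i ∈ range m, ((k : ℚ) + 1 + i - ν)) / m.factorial ≤ (k + m).choose m := by
    rw [div_le_iff₀ (by positivity), mul_comm, ← prod_range_add_cast]
    refine prod_le_prod (fun i _ => ?_) fun i _ => by linarith
    have : (0 : ℚ) ≤ k + i := by positivity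
    linarith
  have b2 : (∏ i ∈ range k, ((m : ℚ) + 1 + i + ν)) / k.factorial ≤ 2 ^ (k + m + 1) := by
    have : (∏ i ∈ range k, ((m : ℚ) + 1 + i + ν)) / k.factorial ≤ ((m + 1) + k).choose k := by
      rw [div_le_iff₀ (by positivity), mul_comm, ← prod_range_add_cast]
      refine prod_le_prod (fun i _ => by positivity) fun i _ => by push_cast; linarith
    refine this.trans ?_
    have h2 := Nat.choose_le_two_pow (m + 1 + k) k
    rw [show k + m + 1 = m + 1 + k by ring]
    exact_mod_cast h2
  unfold padeCoeff
  exact mul_le_mul b1 b2 (by positivity) (by positivity)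

theorem sum_padeCoeff_le {ν : ℚ} (h0 : 0 < ν) (h1 : ν < 1) (n : ℕ) :
    ∑ k ∈ range (n + 1), padeCoeff ν k (n - k) ≤ 2 * 4 ^ n := by
  have h : ∀ k ∈ range (n + 1), padeCoeff ν k (n - k) ≤ n.choose k * 2 ^ (n + 1) := by
    intro k hk
    have hk := Nat.lt_succ_iff.1 (mem_range.1 hk)
    have := padeCoeff_le h0 h1 k (n - k)
    rwa [Nat.add_sub_cancel' hk, Nat.choose_symm hk] at this
  refine (sum_le_sum h).trans ?_
  rw [← sum_mul, ← Nat.cast_sum, Nat.sum_range_choose]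
  push_cast
  rw [show (4 : ℚ) = 2 * 2 by norm_num, mul_pow]
  exact le_of_eq (by ring)

theorem sum_padeCoeff_reverse (ν : ℚ) (n : ℕ) :
    ∑ k ∈ range (n + 1), padeCoeff ν (n - k) k = ∑ k ∈ range (n + 1), padeCoeff ν k (n - k) := by
  rw [← sum_range_reflect]
  refine sum_congr rfl fun k hk => ?_
  have hk := Nat.lt_succ_iff.1 (mem_range.1 hk)
  rw [show n + 1 - 1 - k = n - k by omega, Nat.sub_sub_self hk]

/-- Each product needs one power of r per factor to clear the denominators of 1/r, and as many again
to make the factorial divide. -/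
theorem exists_int_padeCoeff {r : ℕ} (hr : 0 < r) (k m : ℕ) :
    ∃ c : ℤ, (c : ℚ) = (r : ℚ) ^ (2 * (k + m)) * padeCoeff (1 / r) k m := by
  have hr' : (r : ℚ) ≠ 0 := by positivity
  obtain ⟨u, hu⟩ := factorial_dvd_pow_mul_prod r (r * (k + 1) - 1) m
  obtain ⟨v, hv⟩ := factorial_dvd_pow_mul_prod r (r * (m + 1) + 1) k
  have hu' : (r : ℚ) ^ (2 * m) * (∏ i ∈ range m, ((k : ℚ) + 1 + i - 1 / r)) = m.factorial * u := by
    rw [← Nat.cast_mul, ← hu, two_mul, pow_add, mul_assoc]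
    push_cast
    congr 1
    have h4 : (r : ℚ) ^ m = ∏ _i ∈ range m, (r : ℚ) := by simp
    rw [h4, ← prod_mul_distrib]
    refine prod_congr rfl fun i _ => ?_
    rw [Nat.cast_sub (by nlinarith)]
    push_cast
    field_simp
    ring
  have hv' : (r : ℚ) ^ (2 * k) * (∏ i ∈ range k, ((m : ℚ) + 1 + i + 1 / r)) = k.factorial * v := by
    rw [← Nat.cast_mul, ← hv, two_mul, pow_add, mul_assoc]
    push_cast
    congr 1
    have h4 : (r : ℚ) ^ k = ∏ _i ∈ range k, (r : ℚ) := by simp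
    rw [h4, ← prod_mul_distrib]
    refine prod_congr rfl fun i _ => ?_
    field_simp
    ring
  refine ⟨u * v, ?_⟩
  have e : (r : ℚ) ^ (2 * (k + m)) * padeCoeff (1 / r) k m =
      ((r : ℚ) ^ (2 * m) * (∏ i ∈ range m, ((k : ℚ) + 1 + i - 1 / r))) / m.factorial *
      (((r : ℚ) ^ (2 * k) * (∏ i ∈ range k, ((m : ℚ) + 1 + i + 1 / r))) / k.factorial) := by
    rw [padeCoeff, mul_add, pow_add]
    ring
  rw [e, hu', hv']
  push_cast
  field_simp

theorem abs_ringChoose_le_one {ν : ℚ} (h0 : 0 ≤ ν) (h1 : ν ≤ 1) (m : ℕ) :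
    |Ring.choose ν m| ≤ 1 := by
  rw [ringChoose_eq_prod_div, abs_div, Nat.abs_cast, div_le_one (by positivity), abs_prod,
    ← prod_range_add_one_eq_factorial, Nat.cast_prod]
  refine prod_le_prod (fun _ _ => abs_nonneg _) fun i _ => ?_
  have : (0 : ℚ) ≤ i := by positivity
  rw [abs_le]
  push_cast
  constructor <;> linarith

/-- Pascal's rule at most doubles the bound at each unit step of the upper argument. -/
theorem abs_ringChoose_add_natCast_le {ν : ℚ} (h0 : 0 ≤ ν) (h1 : ν ≤ 1) (k m : ℕ) :
    |Ring.choose (ν + k) m| ≤ 2 ^ k := by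
  induction k generalizing m with
  | zero => simpa using abs_ringChoose_le_one h0 h1 m
  | succ k ih =>
    rcases m with _ | m
    · simpa using one_le_pow₀ (M₀ := ℚ) (a := 2) (by norm_num)
    · push_cast
      rw [← add_assoc, Ring.choose_succ_succ, pow_succ, mul_two]
      exact (abs_add_le _ _).trans (add_le_add (ih m) (ih _))

theorem hasSum_ringChoose_mul_pow (s : ℚ) {z : ℂ} (hz : ‖z‖ < 1) :
    HasSum (fun m : ℕ => ((Ring.choose s m : ℚ) : ℂ) * z ^ m) ((1 + z) ^ (s : ℂ)) := by
  have h := (Complex.one_add_cpow_hasFPowerSeriesOnBall_zero (a := (s : ℂ))).hasSum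
    (y := z) (by
      rw [Metric.mem_eball, edist_zero_right, ← ofReal_norm, ENNReal.ofReal_lt_one]
      exact hz)
  rw [zero_add] at h
  convert! h using 1
  funext m
  have := Ring.map_choose (algebraMap ℚ ℂ) s m
  simp only [eq_ratCast] at this
  rw [this, binomialSeries_apply]
  simp

/-- The Taylor coefficients at `x = 1` of the remainder in the Padé approximation of `x ^ ν`. -/
noncomputable def padeRemainderCoeff (ν : ℚ) (n m : ℕ) : ℚ :=
  ∑ k ∈ range (n + 1), padeCoeff ν k (n - k) * Ring.choose (k : ℚ) m -
    ∑ k ∈ range (n + 1), padeCoeff ν (n - k) k * Ring.choose (ν + k) m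

/-- The binomial coefficient of `s` over `m` is a polynomial in `s` of degree m ≤ 2n, so the
vanishing divided difference applies. -/
theorem padeRemainderCoeff_eq_zero {ν : ℚ} (h0 : 0 < ν) (h1 : ν < 1) {n m : ℕ} (hm : m ≤ 2 * n) :
    padeRemainderCoeff ν n m = 0 := by
  have he : ∀ s : ℚ, Ring.choose s m =
      (C ((m.factorial : ℚ)⁻¹) * ∏ j ∈ range m, (X - C (j : ℚ))).eval s := by
    intro s
    rw [ringChoose_eq_prod_div, eval_mul, eval_C, eval_prod, div_eq_inv_mul]
    simp
  simp only [padeRemainderCoeff, he]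
  refine sum_padeCoeff_mul_eval h0 h1 n ((natDegree_C_mul_le _ _).trans ?_)
  rw [natDegree_prod_of_monic _ _ fun j _ => monic_X_sub_C _]
  simp only [natDegree_X_sub_C]
  simpa using hm

theorem abs_padeRemainderCoeff_le {ν : ℚ} (h0 : 0 < ν) (h1 : ν < 1) (n m : ℕ) :
    |padeRemainderCoeff ν n m| ≤ 4 * 8 ^ n := by
  have key : ∀ c d : ℕ → ℚ, (∀ k, 0 ≤ c k) → (∀ k, |d k| ≤ 2 ^ k) →
      ∑ k ∈ range (n + 1), c k ≤ 2 * 4 ^ n → |∑ k ∈ range (n + 1), c k * d k| ≤ 2 * 8 ^ n := by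
    intro c d hc hd hs
    calc |∑ k ∈ range (n + 1), c k * d k| ≤ ∑ k ∈ range (n + 1), |c k * d k| :=
          abs_sum_le_sum_abs _ _
      _ ≤ ∑ k ∈ range (n + 1), c k * 2 ^ n := sum_le_sum fun k hk => by
          rw [abs_mul, abs_of_nonneg (hc k)]
          refine mul_le_mul_of_nonneg_left ((hd k).trans ?_) (hc k)
          exact pow_le_pow_right₀ (by norm_num) (Nat.lt_succ_iff.1 (mem_range.1 hk))
      _ ≤ 2 * 4 ^ n * 2 ^ n := by rw [← sum_mul]; gcongr
      _ = 2 * 8 ^ n := by rw [mul_assoc, ← mul_pow]; norm_num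
  have k1 := key (fun k => padeCoeff ν k (n - k)) (fun k => Ring.choose (k : ℚ) m)
    (fun k => padeCoeff_nonneg h0 h1 _ _)
    (fun k => by simpa using abs_ringChoose_add_natCast_le (ν := 0) le_rfl zero_le_one k m)
    (sum_padeCoeff_le h0 h1 n)
  have k2 := key (fun k => padeCoeff ν (n - k) k) (fun k => Ring.choose (ν + k) m)
    (fun k => padeCoeff_nonneg h0 h1 _ _)
    (fun k => abs_ringChoose_add_natCast_le h0.le h1.le k m)
    ((sum_padeCoeff_reverse ν n).trans_le (sum_padeCoeff_le h0 h1 n))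
  unfold padeRemainderCoeff
  refine (abs_sub _ _).trans ?_
  linarith

theorem hasSum_padeRemainderCoeff (ν : ℚ) (n : ℕ) {z : ℂ} (hz : ‖z‖ < 1) :
    HasSum (fun m : ℕ => (padeRemainderCoeff ν n m : ℂ) * z ^ m)
      (∑ k ∈ range (n + 1), (padeCoeff ν k (n - k) : ℂ) * (1 + z) ^ k -
        (1 + z) ^ (ν : ℂ) * ∑ k ∈ range (n + 1), (padeCoeff ν (n - k) k : ℂ) * (1 + z) ^ k) := by
  have hz1 : 1 + z ≠ 0 := by
    intro h
    rw [show z = -1 by linear_combination h] at hz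
    simp at hz
  have h1 := hasSum_sum (s := range (n + 1)) fun k _ =>
    (hasSum_ringChoose_mul_pow (k : ℚ) hz).mul_left (padeCoeff ν k (n - k) : ℂ)
  have h2 := hasSum_sum (s := range (n + 1)) fun k _ =>
    (hasSum_ringChoose_mul_pow (ν + k) hz).mul_left (padeCoeff ν (n - k) k : ℂ)
  convert! h1.sub h2 using 1
  · funext m
    simp only [padeRemainderCoeff]
    push_cast
    rw [sub_mul, sum_mul, sum_mul]
    congr 1 <;> exact sum_congr rfl fun k _ => by ring
  · congr 1
    · refine sum_congr rfl fun k _ => ?_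
      rw [Rat.cast_natCast, Complex.cpow_natCast]
    · rw [mul_sum]
      refine sum_congr rfl fun k _ => ?_
      rw [Rat.cast_add, Rat.cast_natCast, Complex.cpow_add _ _ hz1, Complex.cpow_natCast]
      ring

/-- The Taylor series starts in degree 2n + 1 and has coefficients at most 4·8^n. For ‖z‖ ≤ 1/2 the
geometric tail costs a factor 2. -/
theorem norm_padeRemainder_le {ν : ℚ} (h0 : 0 < ν) (h1 : ν < 1) (n : ℕ) {z : ℂ}
    (hz : ‖z‖ ≤ 1 / 2) :
    ‖∑ k ∈ range (n + 1), (padeCoeff ν k (n - k) : ℂ) * (1 + z) ^ k -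
        (1 + z) ^ (ν : ℂ) * ∑ k ∈ range (n + 1), (padeCoeff ν (n - k) k : ℂ) * (1 + z) ^ k‖ ≤
      8 * 8 ^ n * ‖z‖ ^ (2 * n + 1) := by
  have hz1 : ‖z‖ < 1 := by linarith
  have h := hasSum_padeRemainderCoeff ν n hz1
  have hz0 : ∑ m ∈ range (2 * n + 1), (padeRemainderCoeff ν n m : ℂ) * z ^ m = 0 := by
    refine sum_eq_zero fun m hm => ?_
    rw [padeRemainderCoeff_eq_zero h0 h1 (by have := mem_range.1 hm; omega)]
    simp
  rw [← hasSum_nat_add_iff' (2 * n + 1), hz0, sub_zero] at h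
  have hg : HasSum (fun m : ℕ => 4 * 8 ^ n * ‖z‖ ^ (2 * n + 1) * ‖z‖ ^ m)
      (4 * 8 ^ n * ‖z‖ ^ (2 * n + 1) * (1 - ‖z‖)⁻¹) :=
    (hasSum_geometric_of_lt_one (norm_nonneg z) hz1).mul_left _
  rw [← h.tsum_eq]
  refine (tsum_of_norm_bounded hg fun m => ?_).trans ?_
  · rw [norm_mul, norm_pow, pow_add, Complex.norm_ratCast]
    have : (|(padeRemainderCoeff ν n (m + (2 * n + 1)) : ℝ)|) ≤ 4 * 8 ^ n := by
      exact_mod_cast abs_padeRemainderCoeff_le h0 h1 n (m + (2 * n + 1))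
    calc _ ≤ (4 * 8 ^ n) * (‖z‖ ^ m * ‖z‖ ^ (2 * n + 1)) := by gcongr
      _ = _ := by ring
  · have : (1 - ‖z‖)⁻¹ ≤ 2 := by
      rw [inv_le_comm₀ (by linarith) (by norm_num)]
      linarith
    calc _ ≤ 4 * 8 ^ n * ‖z‖ ^ (2 * n + 1) * 2 := by gcongr
      _ = _ := by ring

/-- The numerator of the Padé approximant, in the variable `x`. -/
noncomputable def padeNum (ν : ℚ) (n : ℕ) : ℚ[X] :=
  ∑ k ∈ range (n + 1), C (padeCoeff ν k (n - k)) * X ^ k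

/-- The denominator of the Padé approximant, in the variable `x`. -/
noncomputable def padeDen (ν : ℚ) (n : ℕ) : ℚ[X] :=
  ∑ k ∈ range (n + 1), C (padeCoeff ν (n - k) k) * X ^ k

/-- The order of vanishing in formal power series, so that the factor `x ^ ν` can be eliminated
between two consecutive approximants. -/
theorem X_pow_dvd_padeRemainder {ν : ℚ} (h0 : 0 < ν) (h1 : ν < 1) (n : ℕ) :
    (PowerSeries.X : PowerSeries ℚ) ^ (2 * n + 1) ∣
      (((padeNum ν n).comp (1 + X) : ℚ[X]) : PowerSeries ℚ) -
        PowerSeries.binomialSeries ℚ ν * (((padeDen ν n).comp (1 + X) : ℚ[X]) : PowerSeries ℚ) := by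
  rw [PowerSeries.X_pow_dvd_iff]
  intro m hm
  rw [← padeRemainderCoeff_eq_zero h0 h1 (Nat.lt_succ_iff.1 hm), padeRemainderCoeff]
  have hX : ∀ k : ℕ, (((1 + X) ^ k : ℚ[X]) : PowerSeries ℚ) =
      PowerSeries.binomialSeries ℚ (k : ℚ) := by
    intro k
    rw [PowerSeries.binomialSeries_nat]
    simp
  have e : ∀ c : ℕ → ℚ, (((∑ k ∈ range (n + 1), C (c k) * X ^ k : ℚ[X]).comp (1 + X) : ℚ[X]) :
      PowerSeries ℚ) =
      ∑ k ∈ range (n + 1), PowerSeries.C (c k) * PowerSeries.binomialSeries ℚ (k : ℚ) := by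
    intro c
    rw [← coeToPowerSeries.ringHom_apply, Polynomial.sum_comp, map_sum]
    refine sum_congr rfl fun k _ => ?_
    rw [mul_comp, C_comp, X_pow_comp, map_mul, coeToPowerSeries.ringHom_apply,
      coeToPowerSeries.ringHom_apply, hX, Polynomial.coe_C]
  rw [padeNum, padeDen, e, e, map_sub, mul_sum]
  rw [map_sum, map_sum]
  congr 1
  · refine sum_congr rfl fun k _ => ?_
    rw [PowerSeries.coeff_C_mul, PowerSeries.binomialSeries_coeff, smul_eq_mul, mul_one]
  · refine sum_congr rfl fun k _ => ?_
    rw [mul_left_comm, ← PowerSeries.binomialSeries_add, PowerSeries.coeff_C_mul,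
      PowerSeries.binomialSeries_coeff, smul_eq_mul, mul_one]

theorem natDegree_padeNum_le (ν : ℚ) (n : ℕ) : (padeNum ν n).natDegree ≤ n :=
  natDegree_sum_le_of_forall_le _ _ fun _ hk =>
    (natDegree_C_mul_X_pow_le _ _).trans (Nat.lt_succ_iff.1 (mem_range.1 hk))

theorem natDegree_padeDen_le (ν : ℚ) (n : ℕ) : (padeDen ν n).natDegree ≤ n :=
  natDegree_sum_le_of_forall_le _ _ fun _ hk =>
    (natDegree_C_mul_X_pow_le _ _).trans (Nat.lt_succ_iff.1 (mem_range.1 hk))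

theorem padeNum_eval_zero (ν : ℚ) (n : ℕ) : (padeNum ν n).eval 0 = padeCoeff ν 0 n := by
  rw [padeNum, eval_finsetSum, sum_range_succ', sum_eq_zero] <;> simp

theorem padeDen_eval_zero (ν : ℚ) (n : ℕ) : (padeDen ν n).eval 0 = padeCoeff ν n 0 := by
  rw [padeDen, eval_finsetSum, sum_range_succ', sum_eq_zero] <;> simp

/-- Consecutive Padé approximants are independent: their determinant is a nonzero multiple of
`(x - 1) ^ (2n + 1)`. -/
theorem exists_pade_det {ν : ℚ} (h0 : 0 < ν) (h1 : ν < 1) (n : ℕ) :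
    ∃ c : ℚ, c ≠ 0 ∧ padeNum ν n * padeDen ν (n + 1) - padeDen ν n * padeNum ν (n + 1) =
      C c * (X - 1) ^ (2 * n + 1) := by
  set W := padeNum ν n * padeDen ν (n + 1) - padeDen ν n * padeNum ν (n + 1) with hW
  have hdvd : (X : ℚ[X]) ^ (2 * n + 1) ∣ W.comp (1 + X) := by
    have a1 := X_pow_dvd_padeRemainder h0 h1 n
    have a2 := (pow_dvd_pow _ (by omega)).trans (X_pow_dvd_padeRemainder h0 h1 (n + 1))
      (a := (PowerSeries.X : PowerSeries ℚ) ^ (2 * n + 1))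
    -- Cross-multiplying by the two denominators cancels the binomial series and leaves the
    -- polynomial determinant.
    have a3 := dvd_sub (a1.mul_right (((padeDen ν (n + 1)).comp (1 + X) : ℚ[X]) : PowerSeries ℚ))
      (a2.mul_right (((padeDen ν n).comp (1 + X) : ℚ[X]) : PowerSeries ℚ))
    rw [X_pow_dvd_iff]
    rw [PowerSeries.X_pow_dvd_iff] at a3
    intro d hd
    rw [← a3 d hd, ← coeff_coe, hW]
    congr 1
    simp only [sub_comp, mul_comp, Polynomial.coe_sub, Polynomial.coe_mul]
    ring
  obtain ⟨q, hq⟩ := hdvd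
  have hdeg : (W.comp (1 + X)).natDegree ≤ 2 * n + 1 := by
    refine natDegree_comp_le.trans ?_
    have : (1 + X : ℚ[X]).natDegree ≤ 1 := by
      simpa [add_comm] using (natDegree_X_add_C (1 : ℚ)).le
    have h2 : W.natDegree ≤ 2 * n + 1 := by
      refine (natDegree_sub_le _ _).trans (max_le ?_ ?_)
      · refine natDegree_mul_le.trans ?_
        have := natDegree_padeNum_le ν n
        have := natDegree_padeDen_le ν (n + 1)
        omega
      · refine natDegree_mul_le.trans ?_
        have := natDegree_padeDen_le ν n
        have := natDegree_padeNum_le ν (n + 1)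
        omega
    nlinarith
  have hW' : W = (W.comp (1 + X)).comp (X - 1) := by
    rw [comp_assoc]
    simp
  have hq0 : q.natDegree = 0 := by
    by_cases h : q = 0
    · simp [h]
    · rw [hq, natDegree_mul (by simp) h, natDegree_X_pow] at hdeg
      omega
  rw [natDegree_eq_zero] at hq0
  obtain ⟨c, rfl⟩ := hq0
  have hfin : W = C c * (X - 1) ^ (2 * n + 1) := by
    rw [hW', hq, mul_comp, X_pow_comp, C_comp, mul_comm]
  refine ⟨c, ?_, hfin⟩
  rintro rfl
  -- If c = 0 the determinant vanishes at 0. After cancellation its value there is proportional to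
  -- (n + 1 + ν) - (n + 1 - ν) = 2ν, which is not zero.
  have h2 := congrArg (eval 0) hfin
  rw [hW] at h2
  simp only [eval_sub, eval_mul, padeNum_eval_zero, padeDen_eval_zero, C_0, zero_mul,
    eval_zero] at h2
  have p1 := padeCoeff_eq h0 h1 0 n
  have p2 := padeCoeff_eq h0 h1 (n + 1) 0
  have p3 := padeCoeff_eq h0 h1 n 0
  have p4 := padeCoeff_eq h0 h1 0 (n + 1)
  have n1 := prod_one_add_sub_ne_zero h1 n
  have n2 := prod_one_add_add_ne_zero h0 n
  have n3 : (1 + (n : ℚ) - ν) ≠ 0 := by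
    have : (0 : ℚ) ≤ n := by positivity
    linarith
  have n4 : (1 + (n : ℚ) + ν) ≠ 0 := by positivity
  have n5 : ((n + 1).factorial : ℚ) ≠ 0 := by positivity
  have n6 : (n.factorial : ℚ) ≠ 0 := by positivity
  simp only [zero_add, add_zero, prod_range_succ, prod_range_zero, Nat.factorial_zero, Nat.cast_one,
    one_mul, mul_one] at p1 p2 p3 p4
  rw [p1, p2, p3, p4] at h2
  field_simp at h2
  rw [mul_zero] at h2
  have h3 := (mul_eq_zero.1 h2).resolve_left (mul_ne_zero n1 n2)
  linarith

/-- Integral Padé approximants to `x ^ (1 / r)` with explicit bounds. -/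
theorem exists_integral_pade {r : ℕ} (hr : 2 ≤ r) : ∃ c : ℕ → ℕ → ℤ,
    (∀ n (x : ℂ), ‖x‖ ≤ 2 →
      ‖∑ k ∈ range (n + 1), (c n k : ℂ) * x ^ k‖ ≤ 2 * (8 * (r : ℝ) ^ 2) ^ n) ∧
    (∀ n (z : ℂ), ‖z‖ ≤ 1 / 2 →
      ‖∑ k ∈ range (n + 1), (c n k : ℂ) * (1 + z) ^ k -
        (1 + z) ^ (1 / r : ℂ) * ∑ k ∈ range (n + 1), (c n (n - k) : ℂ) * (1 + z) ^ k‖ ≤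
      8 * (8 * (r : ℝ) ^ 2) ^ n * ‖z‖ ^ (2 * n + 1)) ∧
    (∀ n (x : ℂ), x ≠ 1 →
      (∑ k ∈ range (n + 1), (c n k : ℂ) * x ^ k) *
        (∑ k ∈ range (n + 1 + 1), (c (n + 1) (n + 1 - k) : ℂ) * x ^ k) ≠
      (∑ k ∈ range (n + 1), (c n (n - k) : ℂ) * x ^ k) *
        (∑ k ∈ range (n + 1 + 1), (c (n + 1) k : ℂ) * x ^ k)) := by
  set ν : ℚ := 1 / r with hν
  have hr' : (2 : ℚ) ≤ r := by exact_mod_cast hr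
  have h0 : 0 < ν := by positivity
  have h1 : ν < 1 := by rw [hν, div_lt_one (by linarith)]; linarith
  -- For k > n the integer is arbitrary; such indices never occur in the sums.
  have hex : ∀ n k : ℕ, ∃ c : ℤ, k ≤ n → (c : ℚ) = (r : ℚ) ^ (2 * n) * padeCoeff ν k (n - k) := by
    intro n k
    obtain ⟨c, hc⟩ := exists_int_padeCoeff (r := r) (by omega) k (n - k)
    exact ⟨c, fun h => by rw [hc, Nat.add_sub_cancel' h]⟩
  choose c hc using hex
  have hcC : ∀ n k : ℕ, k ≤ n → (c n k : ℂ) = (r : ℂ) ^ (2 * n) * (padeCoeff ν k (n - k) : ℂ) := by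
    intro n k hk
    exact_mod_cast congrArg (fun q : ℚ => (q : ℂ)) (hc n k hk)
  have hN : ∀ n (x : ℂ), ∑ k ∈ range (n + 1), (c n k : ℂ) * x ^ k =
      (r : ℂ) ^ (2 * n) * ∑ k ∈ range (n + 1), (padeCoeff ν k (n - k) : ℂ) * x ^ k := by
    intro n x
    rw [mul_sum]
    refine sum_congr rfl fun k hk => ?_
    rw [hcC n k (Nat.lt_succ_iff.1 (mem_range.1 hk)), mul_assoc]
  have hD : ∀ n (x : ℂ), ∑ k ∈ range (n + 1), (c n (n - k) : ℂ) * x ^ k =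
      (r : ℂ) ^ (2 * n) * ∑ k ∈ range (n + 1), (padeCoeff ν (n - k) k : ℂ) * x ^ k := by
    intro n x
    rw [mul_sum]
    refine sum_congr rfl fun k hk => ?_
    rw [hcC n (n - k) (Nat.sub_le _ _), Nat.sub_sub_self (Nat.lt_succ_iff.1 (mem_range.1 hk)),
      mul_assoc]
  have hrn : ∀ n, ‖(r : ℂ) ^ (2 * n)‖ = ((r : ℝ) ^ 2) ^ n := by
    intro n
    rw [norm_pow, Complex.norm_natCast, pow_mul]
  refine ⟨c, ?_, ?_, ?_⟩
  · intro n x hx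
    rw [hN, norm_mul, hrn]
    have b : ‖∑ k ∈ range (n + 1), (padeCoeff ν k (n - k) : ℂ) * x ^ k‖ ≤ 2 * 4 ^ n * 2 ^ n := by
      calc _ ≤ ∑ k ∈ range (n + 1), (padeCoeff ν k (n - k) : ℝ) * 2 ^ n := by
            refine norm_sum_le_of_le _ fun k hk => ?_
            have hp : (0 : ℝ) ≤ (padeCoeff ν k (n - k) : ℝ) := by
              exact_mod_cast padeCoeff_nonneg h0 h1 k (n - k)
            rw [norm_mul, norm_pow, Complex.norm_ratCast, abs_of_nonneg hp]
            gcongr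
            calc ‖x‖ ^ k ≤ 2 ^ k := by gcongr
              _ ≤ 2 ^ n := pow_le_pow_right₀ (by norm_num) (Nat.lt_succ_iff.1 (mem_range.1 hk))
        _ ≤ 2 * 4 ^ n * 2 ^ n := by
            rw [← sum_mul]
            gcongr
            exact_mod_cast sum_padeCoeff_le h0 h1 n
    calc _ ≤ ((r : ℝ) ^ 2) ^ n * (2 * 4 ^ n * 2 ^ n) := by gcongr
      _ = 2 * ((r : ℝ) ^ 2 * (4 * 2)) ^ n := by rw [mul_pow, mul_pow 4]; ring
      _ = _ := by norm_num [mul_comm]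
  · intro n z hz
    have hb := norm_padeRemainder_le h0 h1 n hz
    have hcast : (1 / r : ℂ) = (ν : ℂ) := by rw [hν]; push_cast; rfl
    rw [hN, hD, hcast, mul_left_comm, ← mul_sub, norm_mul, hrn]
    calc _ ≤ ((r : ℝ) ^ 2) ^ n * (8 * 8 ^ n * ‖z‖ ^ (2 * n + 1)) := by gcongr
      _ = _ := by rw [mul_pow]; ring
  · intro n x hx h
    obtain ⟨d, hd, hW⟩ := exists_pade_det h0 h1 n
    have hW' := congrArg (aeval x) hW
    have en : ∀ n, aeval x (padeNum ν n) =
        ∑ k ∈ range (n + 1), (padeCoeff ν k (n - k) : ℂ) * x ^ k := by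
      intro n; simp [padeNum]
    have ed : ∀ n, aeval x (padeDen ν n) =
        ∑ k ∈ range (n + 1), (padeCoeff ν (n - k) k : ℂ) * x ^ k := by
      intro n; simp [padeDen]
    rw [hN, hD, hN, hD, ← en, ← en, ← ed, ← ed] at h
    simp only [map_sub, map_mul, map_pow, aeval_X, aeval_C, map_one] at hW'
    have hr0 : (r : ℂ) ≠ 0 := by
      have : r ≠ 0 := by omega
      exact_mod_cast this
    have h3 : (r : ℂ) ^ (2 * n) * (r : ℂ) ^ (2 * (n + 1)) *
        ((algebraMap ℚ ℂ) d * (x - 1) ^ (2 * n + 1)) = 0 := by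
      rw [← hW']; linear_combination h
    have h4 : (algebraMap ℚ ℂ) d ≠ 0 := by simpa using hd
    have h5 : x - 1 ≠ 0 := sub_ne_zero.2 hx
    exact mul_ne_zero (mul_ne_zero (pow_ne_zero _ hr0) (pow_ne_zero _ hr0))
      (mul_ne_zero h4 (pow_ne_zero _ h5)) h3

end PadeBounds

/-! ### The quadratic order attached to a diagonalization, and the Liouville lower bound. -/

section Diagonal
open MvPolynomial

/-- A diagonalization together with the primitive quadratic form proportional to the product of
its two linear forms. -/
structure Diagonal (r : ℕ) (F : MvPolynomial (Fin 2) ℤ) where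
  (α β γ δ χ : ℂ)
  (a b c : ℤ)
  isDiag : IsDiagonalization r F α β γ δ
  coeff_sq : α * γ = χ * a
  coeff_mul : α * δ + β * γ = χ * b
  coeff_sq' : β * δ = χ * c
  prim : Int.gcd a (Int.gcd b c) = 1

theorem eval_map_intCast (F : MvPolynomial (Fin 2) ℤ) (x y : ℤ) :
    eval ![(x : ℂ), (y : ℂ)] (map (Int.castRingHom ℂ) F) = ((eval ![x, y] F : ℤ) : ℂ) := by
  have h := eval₂_comp_left (Int.castRingHom ℂ) (RingHom.id ℤ) ![x, y] F
  rw [eval_map, eval, coe_eval₂Hom]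
  refine Eq.trans ?_ h.symm
  congr 1
  funext i
  fin_cases i <;> simp

theorem eval_map_ofReal (F : MvPolynomial (Fin 2) ℤ) (x y : ℝ) :
    eval ![(x : ℂ), (y : ℂ)] (map (Int.castRingHom ℂ) F) = ((aeval ![x, y] F : ℝ) : ℂ) := by
  have h := eval₂_comp_left Complex.ofRealHom (algebraMap ℤ ℝ) ![x, y] F
  rw [eval_map, aeval_def]
  refine Eq.trans ?_ h.symm
  congr 1
  funext i
  fin_cases i <;> simp

namespace IsDiagonalization

variable {r : ℕ} {F : MvPolynomial (Fin 2) ℤ} {α β γ δ : ℂ}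

theorem eval_eq (hF : IsDiagonalization r F α β γ δ) (x y : ℂ) :
    eval ![x, y] (map (Int.castRingHom ℂ) F) = (α * x + β * y) ^ r - (γ * x + δ * y) ^ r := by
  rw [hF.2]
  simp

theorem eval_pderiv_zero (hF : IsDiagonalization r F α β γ δ) (x y : ℂ) :
    eval ![x, y] (map (Int.castRingHom ℂ) (pderiv 0 F)) =
      r * (α * (α * x + β * y) ^ (r - 1) - γ * (γ * x + δ * y) ^ (r - 1)) := by
  rw [← pderiv_map, hF.2]
  simp [Derivation.leibniz_pow, pderiv_X]
  ring

theorem eval_pderiv_one (hF : IsDiagonalization r F α β γ δ) (x y : ℂ) :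
    eval ![x, y] (map (Int.castRingHom ℂ) (pderiv 1 F)) =
      r * (β * (α * x + β * y) ^ (r - 1) - δ * (γ * x + δ * y) ^ (r - 1)) := by
  rw [← pderiv_map, hF.2]
  simp [Derivation.leibniz_pow, pderiv_X]
  ring

end IsDiagonalization

/-- The three coefficients of the product of the two linear forms. -/
theorem coeff_of_mul_eq {α β γ δ χ : ℂ} {a b c : ℤ}
    (h : ((C α * X 0 + C β * X 1) * (C γ * X 0 + C δ * X 1) : MvPolynomial (Fin 2) ℂ) =
      C χ * (C (a : ℂ) * X 0 ^ 2 + C (b : ℂ) * (X 0 * X 1) + C (c : ℂ) * X 1 ^ 2)) :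
    α * γ = χ * a ∧ α * δ + β * γ = χ * b ∧ β * δ = χ * c := by
  have e : ∀ x y : ℂ, (α * x + β * y) * (γ * x + δ * y) =
      χ * (a * x ^ 2 + b * (x * y) + c * y ^ 2) := by
    intro x y
    simpa using congrArg (eval ![x, y]) h
  have e1 := e 1 0
  have e2 := e 0 1
  have e3 := e 1 1
  refine ⟨by linear_combination e1, by linear_combination e3 - e1 - e2, by linear_combination e2⟩

/-- The gcd g of the triple is moved into χ, which changes the discriminant by the positive factor
g². It is nonzero because the squared determinant is χ² times the discriminant of the triple. -/
theorem IsQuadraticDiscr.exists_diagonal {r : ℕ} {F : MvPolynomial (Fin 2) ℤ} {D : ℤ}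
    (hD : IsQuadraticDiscr r F D) :
    ∃ d : Diagonal r F, ∃ g : ℤ, g ≠ 0 ∧ D = g ^ 2 * (d.b ^ 2 - 4 * d.a * d.c) := by
  obtain ⟨α, β, γ, δ, χ, a, b, c, hd, hq, rfl⟩ := hD
  obtain ⟨h1, h2, h3⟩ := coeff_of_mul_eq hq
  set g : ℕ := Int.gcd a (Int.gcd b c) with hg
  have hg0 : 0 < g := by
    rw [Nat.pos_iff_ne_zero]
    intro h0
    rw [hg, Int.gcd_eq_zero_iff, Int.natCast_eq_zero, Int.gcd_eq_zero_iff] at h0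
    obtain ⟨rfl, rfl, rfl⟩ := h0
    apply hd.1
    have : (α * δ - β * γ) ^ 2 = 0 := by
      push_cast at h1 h2 h3
      linear_combination (α * δ + β * γ) * h2 - 4 * α * γ * h3
    exact pow_eq_zero_iff (by norm_num) |>.1 this
  have ha : (g : ℤ) ∣ a := Int.gcd_dvd_left ..
  have hbc : (g : ℤ) ∣ (Int.gcd b c : ℕ) := Int.gcd_dvd_right ..
  obtain ⟨a', ha'⟩ := ha
  obtain ⟨b', hb'⟩ := hbc.trans (Int.gcd_dvd_left ..)
  obtain ⟨c', hc'⟩ := hbc.trans (Int.gcd_dvd_right ..)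
  refine ⟨⟨α, β, γ, δ, χ * g, a', b', c', hd, ?_, ?_, ?_, ?_⟩, g, by exact_mod_cast hg0.ne', ?_⟩
  · rw [h1, ha']; push_cast; ring
  · rw [h2, hb']; push_cast; ring
  · rw [h3, hc']; push_cast; ring
  · have h4 : g = g * Int.gcd a' (Int.gcd b' c') := by
      conv_lhs => rw [hg, ha', hb', hc', Int.gcd_mul_left, Int.natAbs_natCast, Nat.cast_mul,
        Int.gcd_mul_left, Int.natAbs_natCast]
    exact (Nat.eq_of_mul_eq_mul_left hg0 (by rw [← h4, mul_one])).symm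
  · dsimp only
    rw [ha', hb', hc']; ring

/-- `u` and `u'` are conjugate elements of `ℤ[τ]`, where `τ'` is the conjugate of `τ`. -/
def ConjPair (τ τ' u u' : ℂ) : Prop :=
  ∃ m n : ℤ, u = m + n * τ ∧ u' = m + n * τ'

namespace ConjPair

variable {τ τ' u u' v v' : ℂ}

theorem intCast (m : ℤ) : ConjPair τ τ' m m := ⟨m, 0, by simp, by simp⟩

theorem self : ConjPair τ τ' τ τ' := ⟨0, 1, by simp, by simp⟩

theorem add (h : ConjPair τ τ' u u') (k : ConjPair τ τ' v v') :
    ConjPair τ τ' (u + v) (u' + v') := by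
  obtain ⟨m, n, rfl, rfl⟩ := h
  obtain ⟨p, q, rfl, rfl⟩ := k
  exact ⟨m + p, n + q, by push_cast; ring, by push_cast; ring⟩

theorem neg (h : ConjPair τ τ' u u') : ConjPair τ τ' (-u) (-u') := by
  obtain ⟨m, n, rfl, rfl⟩ := h
  exact ⟨-m, -n, by push_cast; ring, by push_cast; ring⟩

theorem symm {b : ℤ} (hs : τ + τ' = b) (h : ConjPair τ τ' u u') : ConjPair τ τ' u' u := by
  obtain ⟨m, n, rfl, rfl⟩ := h
  refine ⟨m + n * b, -n, ?_, ?_⟩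
  · push_cast
    linear_combination n * hs
  · push_cast
    linear_combination n * hs

theorem sub (h : ConjPair τ τ' u u') (k : ConjPair τ τ' v v') :
    ConjPair τ τ' (u - v) (u' - v') := by
  simpa [sub_eq_add_neg] using h.add k.neg

section Mul

variable {b q : ℤ} (hs : τ + τ' = b) (hp : τ * τ' = q)
include hs hp

theorem mul (h : ConjPair τ τ' u u') (k : ConjPair τ τ' v v') :
    ConjPair τ τ' (u * v) (u' * v') := by
  obtain ⟨m, n, rfl, rfl⟩ := h
  obtain ⟨x, y, rfl, rfl⟩ := k
  refine ⟨m * x - n * y * q, m * y + n * x + n * y * b, ?_, ?_⟩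
  · push_cast
    linear_combination n * y * (τ * hs - hp)
  · push_cast
    linear_combination n * y * (τ' * hs - hp)

theorem pow (h : ConjPair τ τ' u u') (n : ℕ) : ConjPair τ τ' (u ^ n) (u' ^ n) := by
  induction n with
  | zero => simpa using intCast (τ := τ) (τ' := τ') 1
  | succ n ih => rw [pow_succ, pow_succ]; exact mul hs hp ih h

theorem mul_conj (h : ConjPair τ τ' u u') : ∃ k : ℤ, u * u' = k := by
  obtain ⟨m, n, rfl, rfl⟩ := h
  refine ⟨m ^ 2 + m * n * b + n ^ 2 * q, ?_⟩
  push_cast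
  linear_combination m * n * hs + n ^ 2 * hp

end Mul

theorem sum {ι : Type*} (t : Finset ι) {f f' : ι → ℂ}
    (h : ∀ i ∈ t, ConjPair τ τ' (f i) (f' i)) : ConjPair τ τ' (∑ i ∈ t, f i) (∑ i ∈ t, f' i) := by
  classical
  induction t using Finset.induction_on with
  | empty => simpa using intCast (τ := τ) (τ' := τ') 0
  | insert i t hi ih =>
    rw [Finset.sum_insert hi, Finset.sum_insert hi]
    exact (h i (by simp)).add (ih fun j hj => h j (by simp [hj]))

/-- The difference is n(τ - τ') with n a nonzero integer. As the pair is formal, the argument also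
covers a square discriminant, where τ is rational. -/
theorem le_norm_sub (h : ConjPair τ τ' u u') (hne : u ≠ u') : ‖τ - τ'‖ ≤ ‖u - u'‖ := by
  obtain ⟨m, n, rfl, rfl⟩ := h
  have hn : n ≠ 0 := by
    rintro rfl
    simp at hne
  have h1 : (1 : ℝ) ≤ ‖(n : ℂ)‖ := by
    rw [Complex.norm_intCast]
    exact_mod_cast Int.one_le_abs hn
  rw [show (m : ℂ) + n * τ - (m + n * τ') = n * (τ - τ') by ring, norm_mul]
  nlinarith [norm_nonneg (τ - τ')]

end ConjPair

namespace Diagonal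

variable {r : ℕ} {F : MvPolynomial (Fin 2) ℤ} (d : Diagonal r F)

/-- The determinant of the two linear forms. -/
noncomputable def det : ℂ := d.α * d.δ - d.β * d.γ

/-- The first linear form at an integer point. -/
noncomputable def xi (p : ℤ × ℤ) : ℂ := d.α * p.1 + d.β * p.2

/-- The second linear form at an integer point. -/
noncomputable def eta (p : ℤ × ℤ) : ℂ := d.γ * p.1 + d.δ * p.2

/-- A generator of the quadratic order in which the values of the forms live. -/
noncomputable def tau : ℂ := d.α * d.δ / d.χ

/-- The conjugate of `tau`. -/
noncomputable def tau' : ℂ := d.β * d.γ / d.χ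

/-- A square root of the discriminant of the quadratic form. -/
noncomputable def sqrtDisc : ℂ := d.tau - d.tau'

theorem det_ne_zero : d.det ≠ 0 := d.isDiag.1

theorem chi_ne_zero : d.χ ≠ 0 := by
  intro h
  have h1 := d.coeff_sq
  have h2 := d.coeff_mul
  have h3 := d.coeff_sq'
  rw [h] at h1 h2 h3
  apply d.det_ne_zero
  have : d.det ^ 2 = 0 := by
    rw [det]
    linear_combination (d.α * d.δ + d.β * d.γ) * h2 - 4 * d.α * d.γ * h3
  exact pow_eq_zero_iff (by norm_num) |>.1 this

theorem tau_add : d.tau + d.tau' = d.b := by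
  have h := d.chi_ne_zero
  rw [tau, tau', ← add_div, d.coeff_mul, mul_div_cancel_left₀ _ h]

theorem tau_mul : d.tau * d.tau' = ((d.a * d.c : ℤ) : ℂ) := by
  have h := d.chi_ne_zero
  rw [tau, tau']
  push_cast
  field_simp
  linear_combination d.β * d.δ * d.coeff_sq + d.χ * d.a * d.coeff_sq'

theorem chi_mul_tau : d.χ * d.tau = d.α * d.δ := mul_div_cancel₀ _ d.chi_ne_zero

theorem chi_mul_tau' : d.χ * d.tau' = d.β * d.γ := mul_div_cancel₀ _ d.chi_ne_zero

theorem chi_mul_sqrtDisc : d.χ * d.sqrtDisc = d.det := by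
  rw [sqrtDisc, mul_sub, chi_mul_tau, chi_mul_tau', det]

theorem sqrtDisc_sq : d.sqrtDisc ^ 2 = ((d.b ^ 2 - 4 * d.a * d.c : ℤ) : ℂ) := by
  have h1 := d.tau_add
  have h2 := d.tau_mul
  push_cast at h2 ⊢
  rw [sqrtDisc]
  linear_combination (d.tau + d.tau' + d.b) * h1 - 4 * h2

theorem sqrtDisc_ne_zero : d.sqrtDisc ≠ 0 := by
  intro h
  apply d.det_ne_zero
  rw [← chi_mul_sqrtDisc, h, mul_zero]

theorem one_le_norm_sqrtDisc : 1 ≤ ‖d.sqrtDisc‖ := by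
  have h := d.sqrtDisc_sq
  have h0 : (d.b ^ 2 - 4 * d.a * d.c) ≠ 0 := by
    intro h0
    rw [h0, Int.cast_zero] at h
    exact d.sqrtDisc_ne_zero (pow_eq_zero_iff two_ne_zero |>.1 h)
  have h1 := congrArg norm h
  rw [norm_pow, Complex.norm_intCast] at h1
  have h2 : (1 : ℝ) ≤ |((d.b ^ 2 - 4 * d.a * d.c : ℤ) : ℝ)| := by
    exact_mod_cast Int.one_le_abs h0
  rw [← h1] at h2
  exact (one_le_sq_iff₀ (norm_nonneg _)).1 h2

theorem norm_det : ‖d.det‖ = ‖d.χ‖ * ‖d.sqrtDisc‖ := by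
  rw [← chi_mul_sqrtDisc, norm_mul]

theorem eval_eq (p : ℤ × ℤ) : ((eval ![p.1, p.2] F : ℤ) : ℂ) = d.xi p ^ r - d.eta p ^ r := by
  rw [← eval_map_intCast, d.isDiag.eval_eq, xi, eta]

theorem xi_mul_eta_sub (p q : ℤ × ℤ) :
    d.xi p * d.eta q - d.xi q * d.eta p = d.det * ((p.1 * q.2 - q.1 * p.2 : ℤ) : ℂ) := by
  rw [xi, xi, eta, eta, det]
  push_cast
  ring

theorem conjPair_xi_mul_eta (p q : ℤ × ℤ) :
    ConjPair d.tau d.tau' (d.xi p * d.eta q / d.χ) (d.xi q * d.eta p / d.χ) := by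
  have h := d.chi_ne_zero
  have hs := d.tau_add
  refine ⟨d.a * p.1 * q.1 + d.c * p.2 * q.2 + d.b * (q.1 * p.2), p.1 * q.2 - q.1 * p.2, ?_, ?_⟩
  · rw [div_eq_iff h, xi, eta]
    push_cast
    linear_combination (p.1 * q.1 : ℂ) * d.coeff_sq + (p.2 * q.2 : ℂ) * d.coeff_sq' +
      (q.1 * p.2 : ℂ) * d.coeff_mul - (p.1 * q.2 - q.1 * p.2 : ℂ) * d.chi_mul_tau
  · rw [div_eq_iff h, xi, eta]
    push_cast
    linear_combination (p.1 * q.1 : ℂ) * d.coeff_sq + (p.2 * q.2 : ℂ) * d.coeff_sq' +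
      (q.1 * p.2 : ℂ) * d.coeff_mul - (p.1 * q.2 - q.1 * p.2 : ℂ) * d.chi_mul_tau'

/-- Cramer's rule: δF_x - γF_y = r·det·ξ^(r-1). Multiplying by ξ and dividing by χ leaves
coefficients among a, c, τ, τ'. Hence r·sqrtDisc·ξ^r lies in ℤ[τ] at integer points. -/
theorem mul_xi_pow (hr : 0 < r) (x y : ℂ) :
    r * d.sqrtDisc * (d.α * x + d.β * y) ^ r =
      (d.tau * x + d.c * y) * eval ![x, y] (map (Int.castRingHom ℂ) (pderiv 0 F)) -
      (d.a * x + d.tau' * y) * eval ![x, y] (map (Int.castRingHom ℂ) (pderiv 1 F)) := by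
  obtain ⟨n, rfl⟩ : ∃ n, r = n + 1 := ⟨r - 1, by omega⟩
  apply mul_left_cancel₀ d.chi_ne_zero
  rw [d.isDiag.eval_pderiv_zero, d.isDiag.eval_pderiv_one, Nat.add_sub_cancel]
  have e := d.chi_mul_sqrtDisc
  rw [det] at e
  set A := (d.α * x + d.β * y)
  set B := (d.γ * x + d.δ * y)
  linear_combination (exp := 1) ((n + 1 : ℕ) : ℂ) * A ^ (n + 1) * e -
    ((n + 1 : ℕ) : ℂ) * (d.α * A ^ n - d.γ * B ^ n) * (x * d.chi_mul_tau - y * d.coeff_sq') +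
    ((n + 1 : ℕ) : ℂ) * (d.β * A ^ n - d.δ * B ^ n) * (y * d.chi_mul_tau' - x * d.coeff_sq)

theorem mul_eta_pow (hr : 0 < r) (x y : ℂ) :
    r * d.sqrtDisc * (d.γ * x + d.δ * y) ^ r =
      (d.tau' * x + d.c * y) * eval ![x, y] (map (Int.castRingHom ℂ) (pderiv 0 F)) -
      (d.a * x + d.tau * y) * eval ![x, y] (map (Int.castRingHom ℂ) (pderiv 1 F)) := by
  obtain ⟨n, rfl⟩ : ∃ n, r = n + 1 := ⟨r - 1, by omega⟩
  apply mul_left_cancel₀ d.chi_ne_zero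
  rw [d.isDiag.eval_pderiv_zero, d.isDiag.eval_pderiv_one, Nat.add_sub_cancel]
  have e := d.chi_mul_sqrtDisc
  rw [det] at e
  set A := (d.α * x + d.β * y)
  set B := (d.γ * x + d.δ * y)
  linear_combination (exp := 1) ((n + 1 : ℕ) : ℂ) * B ^ (n + 1) * e -
    ((n + 1 : ℕ) : ℂ) * (d.α * A ^ n - d.γ * B ^ n) * (x * d.chi_mul_tau' - y * d.coeff_sq') +
    ((n + 1 : ℕ) : ℂ) * (d.β * A ^ n - d.δ * B ^ n) * (y * d.chi_mul_tau - x * d.coeff_sq)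

theorem conjPair_xi_pow (hr : 0 < r) (p : ℤ × ℤ) :
    ConjPair d.tau d.tau' (r * d.sqrtDisc * d.xi p ^ r) (r * d.sqrtDisc * d.eta p ^ r) := by
  rw [xi, eta, d.mul_xi_pow hr, d.mul_eta_pow hr]
  simp only [eval_map_intCast]
  have hs := d.tau_add
  have hp := d.tau_mul
  have hi : ∀ m : ℤ, ConjPair d.tau d.tau' m m := ConjPair.intCast
  have h1 := (ConjPair.mul hs hp .self (hi p.1)).add (ConjPair.mul hs hp (hi d.c) (hi p.2))
  have h2 : ConjPair d.tau d.tau' (d.a * p.1 + d.tau' * p.2) (d.a * p.1 + d.tau * p.2) := by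
    have h := (ConjPair.mul hs hp (hi d.a) (hi p.1)).add
      (ConjPair.mul hs hp ((hi d.b).sub .self) (hi p.2))
    convert h using 3
    · linear_combination hs
    · linear_combination hs
  exact (ConjPair.mul hs hp h1 (hi _)).sub (ConjPair.mul hs hp h2 (hi _))

theorem xi_mul_eta (p : ℤ × ℤ) : d.xi p * d.eta p =
    d.χ * ((d.a * p.1 ^ 2 + d.b * (p.1 * p.2) + d.c * p.2 ^ 2 : ℤ) : ℂ) := by
  rw [xi, eta]
  push_cast
  linear_combination (p.1 ^ 2 : ℂ) * d.coeff_sq + (p.1 * p.2 : ℂ) * d.coeff_mul +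
    (p.2 ^ 2 : ℂ) * d.coeff_sq'

/-- Gauss's lemma for the product of the two conjugate `r`-th powers. -/
theorem exists_int_eq (hr : 0 < r) : ∃ m : ℤ, (r : ℂ) ^ 2 * d.sqrtDisc ^ 2 * d.χ ^ r = m := by
  set N : ℂ := (r : ℂ) ^ 2 * d.sqrtDisc ^ 2 * d.χ ^ r with hN
  have hval : ∀ p : ℤ × ℤ, ∃ m : ℤ,
      N * ((d.a * p.1 ^ 2 + d.b * (p.1 * p.2) + d.c * p.2 ^ 2 : ℤ) : ℂ) ^ r = m := by
    intro p
    obtain ⟨m, hm⟩ := (d.conjPair_xi_pow hr p).mul_conj d.tau_add d.tau_mul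
    refine ⟨m, ?_⟩
    rw [← hm, hN, mul_assoc _ (d.χ ^ r), ← mul_pow d.χ, ← xi_mul_eta, mul_pow]
    ring
  -- The integers n for which N·n is an integer form an ideal. It contains the r-th powers of the
  -- values a, c, a + b + c of the quadratic form; these values generate the unit ideal, so their
  -- powers do too.
  let I : Ideal ℤ :=
    { carrier := {n | ∃ m : ℤ, N * (n : ℂ) = m}
      add_mem' := by
        rintro x y ⟨m, hm⟩ ⟨k, hk⟩
        exact ⟨m + k, by push_cast; rw [mul_add, hm, hk]⟩
      zero_mem' := ⟨0, by simp⟩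
      smul_mem' := by
        rintro x y ⟨m, hm⟩
        exact ⟨x * m, by push_cast; rw [← hm]; simp; ring⟩ }
  have htop : Ideal.span ({d.a, d.c, d.a + d.b + d.c} : Set ℤ) = ⊤ := by
    rw [Ideal.eq_top_iff_one]
    have ha : d.a ∈ Ideal.span ({d.a, d.c, d.a + d.b + d.c} : Set ℤ) :=
      Ideal.subset_span (by simp)
    have hc : d.c ∈ Ideal.span ({d.a, d.c, d.a + d.b + d.c} : Set ℤ) :=
      Ideal.subset_span (by simp)
    have habc : d.a + d.b + d.c ∈ Ideal.span ({d.a, d.c, d.a + d.b + d.c} : Set ℤ) :=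
      Ideal.subset_span (by simp)
    have hb : d.b ∈ Ideal.span ({d.a, d.c, d.a + d.b + d.c} : Set ℤ) := by
      have := Ideal.sub_mem _ (Ideal.sub_mem _ habc ha) hc
      rwa [show d.a + d.b + d.c - d.a - d.c = d.b by ring] at this
    have h1 := Int.gcd_eq_gcd_ab d.a (Int.gcd d.b d.c)
    have h2 := Int.gcd_eq_gcd_ab d.b d.c
    rw [d.prim, h2] at h1
    rw [show (1 : ℤ) = ((1 : ℕ) : ℤ) by rfl, h1]
    exact Ideal.add_mem _ (Ideal.mul_mem_right _ _ ha)
      (Ideal.mul_mem_right _ _ (Ideal.add_mem _ (Ideal.mul_mem_right _ _ hb)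
        (Ideal.mul_mem_right _ _ hc)))
  have hI : (1 : ℤ) ∈ I := by
    have h := Ideal.span_pow_eq_top _ htop r
    have hle : Ideal.span ((fun x => x ^ r) '' ({d.a, d.c, d.a + d.b + d.c} : Set ℤ)) ≤ I := by
      rw [Ideal.span_le]
      rintro _ ⟨x, hx, rfl⟩
      rcases hx with rfl | rfl | rfl
      · simpa [I] using hval (1, 0)
      · simpa [I] using hval (0, 1)
      · simpa [I] using hval (1, 1)
    rw [h] at hle
    exact hle trivial
  simpa [I] using hI

/-- The integer r²·sqrtDisc²·χ^r is nonzero, so of absolute value at least 1; χ is then eliminated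
through |det| = |χ||sqrtDisc|. This controls the quadratic discriminant by the determinant. -/
theorem norm_sqrtDisc_pow_le (hr : 2 ≤ r) :
    ‖d.sqrtDisc‖ ^ (r - 2) ≤ (r : ℝ) ^ 2 * ‖d.det‖ ^ r := by
  obtain ⟨m, hm⟩ := d.exists_int_eq (by omega)
  have hm0 : m ≠ 0 := by
    rintro rfl
    have : (r : ℂ) ≠ 0 := by
      have : r ≠ 0 := by omega
      exact_mod_cast this
    exact mul_ne_zero (mul_ne_zero (pow_ne_zero 2 this) (pow_ne_zero 2 d.sqrtDisc_ne_zero))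
      (pow_ne_zero r d.chi_ne_zero) (by simpa using hm)
  have h1 : 1 ≤ (r : ℝ) ^ 2 * ‖d.sqrtDisc‖ ^ 2 * ‖d.χ‖ ^ r := by
    have h2 := congrArg norm hm
    rw [norm_mul, norm_mul, norm_pow, norm_pow, norm_pow, Complex.norm_natCast,
      Complex.norm_intCast] at h2
    rw [h2]
    exact_mod_cast Int.one_le_abs hm0
  calc ‖d.sqrtDisc‖ ^ (r - 2) = ‖d.sqrtDisc‖ ^ (r - 2) * 1 := (mul_one _).symm
    _ ≤ ‖d.sqrtDisc‖ ^ (r - 2) * ((r : ℝ) ^ 2 * ‖d.sqrtDisc‖ ^ 2 * ‖d.χ‖ ^ r) := by gcongr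
    _ = (r : ℝ) ^ 2 * (‖d.χ‖ ^ r * ‖d.sqrtDisc‖ ^ (r - 2 + 2)) := by rw [pow_add]; ring
    _ = (r : ℝ) ^ 2 * ‖d.det‖ ^ r := by rw [Nat.sub_add_cancel hr, norm_det, mul_pow]

/-- A Liouville type lower bound for the approximation forms. -/
theorem norm_det_le (hr : 0 < r) (n : ℕ) (c : ℕ → ℤ) (p q : ℤ × ℤ)
    (hne : d.xi p * d.eta q * ∑ k ∈ Finset.range (n + 1),
        (c k : ℂ) * ((d.xi p ^ r) ^ (n - k) * (d.eta p ^ r) ^ k) ≠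
      d.xi q * d.eta p * ∑ k ∈ Finset.range (n + 1),
        (c k : ℂ) * ((d.eta p ^ r) ^ (n - k) * (d.xi p ^ r) ^ k)) :
    ‖d.det‖ ≤ (r * ‖d.sqrtDisc‖) ^ n *
      ‖d.xi p * d.eta q * ∑ k ∈ Finset.range (n + 1),
        (c k : ℂ) * ((d.xi p ^ r) ^ (n - k) * (d.eta p ^ r) ^ k) -
      d.xi q * d.eta p * ∑ k ∈ Finset.range (n + 1),
        (c k : ℂ) * ((d.eta p ^ r) ^ (n - k) * (d.xi p ^ r) ^ k)‖ := by
  have hs := d.tau_add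
  have hp := d.tau_mul
  have hχ := d.chi_ne_zero
  set κ : ℂ := r * d.sqrtDisc with hκ
  have hκ0 : κ ≠ 0 := mul_ne_zero (by exact_mod_cast hr.ne') d.sqrtDisc_ne_zero
  have hX := d.conjPair_xi_pow hr p
  have hY := hX.symm hs
  have hsum : ConjPair d.tau d.tau'
      (∑ k ∈ Finset.range (n + 1), (c k : ℂ) * ((κ * d.xi p ^ r) ^ (n - k) * (κ * d.eta p ^ r) ^ k))
      (∑ k ∈ Finset.range (n + 1),
        (c k : ℂ) * ((κ * d.eta p ^ r) ^ (n - k) * (κ * d.xi p ^ r) ^ k)) :=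
    ConjPair.sum _ fun k _ => .mul hs hp (.intCast _)
      (.mul hs hp (.pow hs hp hX _) (.pow hs hp hY _))
  -- The sums are homogeneous of degree n, so replacing ξ^r, η^r by the integral elements κξ^r, κη^r
  -- costs exactly κ^n.
  have hhom : ∀ u v : ℂ, ∑ k ∈ Finset.range (n + 1), (c k : ℂ) * ((κ * u) ^ (n - k) * (κ * v) ^ k) =
      κ ^ n * ∑ k ∈ Finset.range (n + 1), (c k : ℂ) * (u ^ (n - k) * v ^ k) := by
    intro u v
    rw [Finset.mul_sum]
    refine Finset.sum_congr rfl fun k hk => ?_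
    have hk' : n = n - k + k := by have := Finset.mem_range.1 hk; omega
    rw [mul_pow, mul_pow]
    conv_rhs => rw [hk', pow_add, ← hk']
    ring
  rw [hhom, hhom] at hsum
  have hprod := (d.conjPair_xi_mul_eta p q).mul hs hp hsum
  set S := ∑ k ∈ Finset.range (n + 1), (c k : ℂ) * ((d.xi p ^ r) ^ (n - k) * (d.eta p ^ r) ^ k)
  set S' := ∑ k ∈ Finset.range (n + 1), (c k : ℂ) * ((d.eta p ^ r) ^ (n - k) * (d.xi p ^ r) ^ k)
  have heq : d.xi p * d.eta q / d.χ * (κ ^ n * S) - d.xi q * d.eta p / d.χ * (κ ^ n * S') =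
      κ ^ n / d.χ * (d.xi p * d.eta q * S - d.xi q * d.eta p * S') := by
    field_simp
  have hbound := hprod.le_norm_sub (by
    rw [← sub_ne_zero, heq]
    exact mul_ne_zero (div_ne_zero (pow_ne_zero n hκ0) hχ) (sub_ne_zero.2 hne))
  have hχ' : 0 < ‖d.χ‖ := norm_pos_iff.2 hχ
  rw [heq, norm_mul, norm_div, norm_pow, hκ, norm_mul, Complex.norm_natCast, div_mul_eq_mul_div,
    le_div_iff₀ hχ'] at hbound
  rw [norm_det, mul_comm]
  exact hbound

end Diagonal

end Diagonal

/-! ### The discriminant in terms of the determinant, and the consequence of the hypothesis. -/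

section Discriminant
open MvPolynomial

theorem prod_prod_Ioi_sq {n : ℕ} (f : Fin n → Fin n → ℝ) (hf : ∀ i j, f i j = f j i) :
    ∏ i, ∏ j ∈ Finset.Ioi i, f i j ^ 2 = ∏ i, ∏ j ∈ Finset.univ.erase i, f i j := by
  have h1 : ∀ i, ∏ j ∈ Finset.univ.erase i, f i j =
      (∏ j ∈ Finset.Ioi i, f i j) * ∏ j ∈ Finset.Iio i, f i j := by
    intro i
    rw [← Finset.prod_union]
    · congr 1
      ext j
      simp [lt_or_lt_iff_ne, eq_comm]
    · rw [Finset.disjoint_left]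
      intro j hj hj'
      exact absurd (Finset.mem_Ioi.1 hj) (not_lt.2 (Finset.mem_Iio.1 hj').le)
  have h2 : ∏ i, ∏ j ∈ Finset.Iio i, f i j = ∏ i, ∏ j ∈ Finset.Ioi i, f i j := by
    rw [Finset.prod_comm' (t' := Finset.univ) (s' := fun j => Finset.Ioi j) (by simp)]
    exact Finset.prod_congr rfl fun i _ => Finset.prod_congr rfl fun j _ => hf _ _
  rw [Finset.prod_congr rfl fun i _ => h1 i, Finset.prod_mul_distrib, h2, ← Finset.prod_mul_distrib]
  refine Finset.prod_congr rfl fun i _ => ?_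
  rw [Finset.prod_pow, sq]

/-- At the zero (b_i, -a_i) of the i-th factor, |ξ| = |η|, and the derivatives of F give the product
over j ≠ i of |a_i b_j - a_j b_i| as r|J||ξ_i|^(r-2). The product of all |ξ_i| is |F(β, -α)| =
|J|^r. -/
theorem IsDiagonalization.norm_discriminant {r : ℕ} (hr : 2 ≤ r) {F : MvPolynomial (Fin 2) ℤ}
    {α β γ δ Δ : ℂ} (hF : IsDiagonalization r F α β γ δ) (hΔ : IsDiscriminant r F Δ) :
    ‖Δ‖ = (r : ℝ) ^ r * ‖α * δ - β * γ‖ ^ (r * (r - 1)) := by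
  obtain ⟨a, b, hprod, rfl⟩ := hΔ
  have hev : ∀ x y : ℂ, ∏ i, (a i * x + b i * y) = (α * x + β * y) ^ r - (γ * x + δ * y) ^ r := by
    intro x y
    rw [← hF.eval_eq, hprod, map_prod]
    simp
  set J := α * δ - β * γ with hJ
  have hJ0 : J ≠ 0 := hF.1
  have hab : ∀ i, ¬ (a i = 0 ∧ b i = 0) := by
    rintro i ⟨ha, hb⟩
    have h := hev δ (-γ)
    rw [Finset.prod_eq_zero (Finset.mem_univ i) (by rw [ha, hb]; ring),
      show γ * δ + δ * -γ = 0 by ring, zero_pow (by omega), sub_zero] at h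
    refine hJ0 ?_
    have := pow_eq_zero_iff (by omega) |>.1 h.symm
    rw [hJ, ← this]; ring
  set ξ : Fin r → ℂ := fun i => α * b i + β * -a i with hξ
  set η : Fin r → ℂ := fun i => γ * b i + δ * -a i with hη
  have hnorm : ∀ i, ‖ξ i‖ = ‖η i‖ := by
    intro i
    have h := hev (b i) (-a i)
    rw [Finset.prod_eq_zero (Finset.mem_univ i) (by ring)] at h
    have h2 := congrArg norm (sub_eq_zero.1 h.symm)
    rw [norm_pow, norm_pow] at h2
    exact (pow_left_inj₀ (norm_nonneg _) (norm_nonneg _) (by omega)).1 h2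
  have hξ0 : ∀ i, ξ i ≠ 0 := by
    intro i h0
    have h1 : η i = 0 := by rw [← norm_eq_zero, ← hnorm i, h0, norm_zero]
    simp only [hξ] at h0
    simp only [hη] at h1
    refine hab i ⟨?_, ?_⟩
    · refine (mul_eq_zero.1 (?_ : J * a i = 0)).resolve_left hJ0
      rw [hJ]; linear_combination γ * h0 - α * h1
    · refine (mul_eq_zero.1 (?_ : J * b i = 0)).resolve_left hJ0
      rw [hJ]; linear_combination δ * h0 - β * h1
  have hR : ∀ i, ∏ j ∈ Finset.univ.erase i, ‖a i * b j - a j * b i‖ =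
      r * ‖J‖ * ‖ξ i‖ ^ (r - 2) := by
    intro i
    set R : MvPolynomial (Fin 2) ℂ :=
      ∏ j ∈ Finset.univ.erase i, (C (a j) * X 0 + C (b j) * X 1) with hRdef
    have hfac : map (Int.castRingHom ℂ) F = (C (a i) * X 0 + C (b i) * X 1) * R := by
      rw [hprod, hRdef]
      exact (Finset.mul_prod_erase _ (fun j => C (a j) * X 0 + C (b j) * X 1)
        (Finset.mem_univ i)).symm
    have e0 := hF.eval_pderiv_zero (b i) (-a i)
    have e1 := hF.eval_pderiv_one (b i) (-a i)
    rw [← pderiv_map, hfac] at e0 e1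
    have q0 : eval ![b i, -a i] (pderiv 0 ((C (a i) * X 0 + C (b i) * X 1) * R)) =
        a i * eval ![b i, -a i] R := by
      simp [Derivation.leibniz, pderiv_X]
      ring_nf
    have q1 : eval ![b i, -a i] (pderiv 1 ((C (a i) * X 0 + C (b i) * X 1) * R)) =
        b i * eval ![b i, -a i] R := by
      simp [Derivation.leibniz, pderiv_X]
      ring_nf
    rw [q0] at e0
    rw [q1] at e1
    -- The combination δF_x - γF_y isolates ξ^(r-1); applied to the i-th linear factor it gives δa_i
    -- - γb_i = -η_i.
    have key : -η i * eval ![b i, -a i] R = r * J * ξ i ^ (r - 1) := by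
      simp only [hη, hξ, hJ]
      linear_combination δ * e0 - γ * e1
    have hRn : ‖eval ![b i, -a i] R‖ = ∏ j ∈ Finset.univ.erase i, ‖a i * b j - a j * b i‖ := by
      rw [hRdef, map_prod, norm_prod]
      refine Finset.prod_congr rfl fun j _ => ?_
      rw [← norm_neg]
      congr 1
      simp
      ring
    have h3 := congrArg norm key
    rw [norm_mul, norm_neg, ← hnorm i, hRn, norm_mul, norm_mul, Complex.norm_natCast, norm_pow,
      show r - 1 = r - 2 + 1 by omega, pow_succ] at h3
    have h4 : ‖ξ i‖ ≠ 0 := norm_ne_zero_iff.2 (hξ0 i)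
    apply mul_left_cancel₀ h4
    rw [h3]
    ring
  have hξprod : ∏ i, ‖ξ i‖ = ‖J‖ ^ r := by
    have h := hev β (-α)
    rw [show α * β + β * -α = 0 by ring, zero_pow (by omega), zero_sub,
      show γ * β + δ * -α = -J by rw [hJ]; ring] at h
    have h2 := congrArg norm h
    rw [norm_neg, norm_pow, norm_neg, norm_prod] at h2
    rw [← h2]
    refine Finset.prod_congr rfl fun i _ => ?_
    rw [← norm_neg]
    congr 1
    simp only [hξ]
    ring
  rw [norm_prod]
  have h5 : ∀ i, ‖∏ j ∈ Finset.Ioi i, (a i * b j - a j * b i) ^ 2‖ =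
      ∏ j ∈ Finset.Ioi i, ‖a i * b j - a j * b i‖ ^ 2 := by
    intro i
    rw [norm_prod]
    exact Finset.prod_congr rfl fun j _ => norm_pow _ _
  rw [Finset.prod_congr rfl fun i _ => h5 i,
    prod_prod_Ioi_sq (fun i j => ‖a i * b j - a j * b i‖) fun i j => by
      rw [← norm_neg]; congr 1; ring,
    Finset.prod_congr rfl fun i _ => hR i, Finset.prod_mul_distrib, Finset.prod_pow, hξprod,
    Finset.prod_const, Finset.card_univ, Fintype.card_fin, mul_pow, mul_assoc, ← pow_mul, ← pow_add]
  congr 2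
  obtain ⟨n, rfl⟩ : ∃ n, r = n + 2 := ⟨r - 2, by omega⟩
  rw [show n + 2 - 2 = n by omega, show n + 2 - 1 = n + 1 by omega]
  ring

/-- Δ' is the (r-1)-st power of (J/2)^r / h². As r² - 5r - 2 is positive and at most r² and r² - r +
2, the exponents may be lowered to 13(r-1) and 4(r-1), and an (r-1)-st root is taken. -/
theorem pow_le_of_deltaPrime {r : ℕ} (hr : 6 ≤ r) {Δ : ℂ} {h : ℤ} (hh : 0 < h) {J : ℝ} (hJ : 0 ≤ J)
    (hΔ : ‖Δ‖ = (r : ℝ) ^ r * J ^ (r * (r - 1)))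
    (hΔ' : (r : ℝ) ^ (13 * (r : ℝ) ^ 2 * ((r : ℝ) - 1) / ((r : ℝ) ^ 2 - 5 * (r : ℝ) - 2)) *
        (h : ℝ) ^ (4 * ((r : ℝ) - 1) * ((r : ℝ) ^ 2 - (r : ℝ) + 2) /
          ((r : ℝ) ^ 2 - 5 * (r : ℝ) - 2)) ≤ deltaPrime r Δ h) :
    (r : ℝ) ^ 13 * (h : ℝ) ^ 6 ≤ (J / 2) ^ r := by
  have hr6 : (6 : ℝ) ≤ r := by exact_mod_cast hr
  have hr0 : (0 : ℝ) < r := by linarith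
  have hh1 : (1 : ℝ) ≤ h := by exact_mod_cast hh
  have hE : 0 < (r : ℝ) ^ 2 - 5 * (r : ℝ) - 2 := by nlinarith
  have hcast : ((r - 1 : ℕ) : ℝ) = r - 1 := by rw [Nat.cast_sub (by omega)]; simp
  have e1 : ((r : ℝ) ^ 13) ^ (r - 1) ≤
      (r : ℝ) ^ (13 * (r : ℝ) ^ 2 * ((r : ℝ) - 1) / ((r : ℝ) ^ 2 - 5 * (r : ℝ) - 2)) := by
    rw [← pow_mul, ← Real.rpow_natCast]
    refine Real.rpow_le_rpow_of_exponent_le (by linarith) ?_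
    rw [le_div_iff₀ hE]
    push_cast
    rw [hcast]
    have : 0 ≤ 13 * ((r : ℝ) - 1) := by linarith
    nlinarith
  have e2 : ((h : ℝ) ^ 4) ^ (r - 1) ≤ (h : ℝ) ^ (4 * ((r : ℝ) - 1) * ((r : ℝ) ^ 2 - (r : ℝ) + 2) /
      ((r : ℝ) ^ 2 - 5 * (r : ℝ) - 2)) := by
    rw [← pow_mul, ← Real.rpow_natCast]
    refine Real.rpow_le_rpow_of_exponent_le hh1 ?_
    rw [le_div_iff₀ hE]
    push_cast
    rw [hcast]
    have : 0 ≤ 4 * ((r : ℝ) - 1) := by linarith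
    nlinarith
  have e3 : deltaPrime r Δ h = ((J / 2) ^ r / (h : ℝ) ^ 2) ^ (r - 1) := by
    rw [deltaPrime, hΔ, div_pow, div_pow, div_pow, ← pow_mul, ← pow_mul, ← pow_mul,
      show r ^ 2 - r = r * (r - 1) by rw [Nat.mul_sub, sq, mul_one],
      show 2 * r - 2 = 2 * (r - 1) by omega]
    field_simp
  have e4 : ((r : ℝ) ^ 13 * (h : ℝ) ^ 4) ^ (r - 1) ≤ ((J / 2) ^ r / (h : ℝ) ^ 2) ^ (r - 1) := by
    rw [mul_pow, ← e3]
    refine le_trans ?_ hΔ'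
    gcongr
  have e5 := (pow_le_pow_iff_left₀ (by positivity) (by positivity) (by omega)).1 e4
  rw [le_div_iff₀ (by positivity)] at e5
  calc (r : ℝ) ^ 13 * (h : ℝ) ^ 6 = (r : ℝ) ^ 13 * (h : ℝ) ^ 4 * (h : ℝ) ^ 2 := by ring
    _ ≤ _ := e5

end Discriminant

/-! ### Small solutions, roots of unity, the gap principle and the Padé inequality. -/

section Solutions
open MvPolynomial

theorem eq_or_eq_neg_of_det_eq_zero {p q : ℤ × ℤ} (hp : Int.gcd p.1 p.2 = 1)
    (hq : Int.gcd q.1 q.2 = 1) (h : p.1 * q.2 - q.1 * p.2 = 0) : q = p ∨ q = -p := by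
  obtain ⟨x, y⟩ := p
  obtain ⟨z, w⟩ := q
  simp only at hp hq h
  have hb := Int.gcd_eq_gcd_ab x y
  rw [hp] at hb
  push_cast at hb
  set u := Int.gcdA x y
  set v := Int.gcdB x y
  have hz : z = (z * u + w * v) * x := by linear_combination z * hb - v * h
  have hw : w = (z * u + w * v) * y := by linear_combination w * hb + u * h
  set t := z * u + w * v
  have ht : t.natAbs = 1 := by
    rw [hz, hw, Int.gcd_mul_left, hp, mul_one] at hq
    exact hq
  rcases Int.natAbs_eq t with h1 | h1 <;> rw [ht] at h1
  · left
    rw [hz, hw, h1]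
    simp
  · right
    rw [hz, hw, h1]
    simp

theorem norm_one_add_cpow_sub_one_le {ν : ℚ} (h0 : 0 ≤ ν) (h1 : ν ≤ 1) {z : ℂ}
    (hz : ‖z‖ ≤ 1 / 2) : ‖(1 + z) ^ (ν : ℂ) - 1‖ ≤ 2 * ‖z‖ := by
  have hz1 : ‖z‖ < 1 := by linarith
  have h := hasSum_ringChoose_mul_pow ν hz1
  rw [← hasSum_nat_add_iff' 1] at h
  simp only [Finset.sum_range_one, pow_zero, Ring.choose_zero_right, Rat.cast_one, mul_one] at h
  rw [← h.tsum_eq]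
  refine (tsum_of_norm_bounded ((hasSum_geometric_of_lt_one (norm_nonneg z) hz1).mul_left ‖z‖)
    fun m => ?_).trans ?_
  · rw [norm_mul, norm_pow, Complex.norm_ratCast, pow_succ]
    have h2 : |((Ring.choose ν (m + 1) : ℚ) : ℝ)| ≤ 1 := by
      exact_mod_cast abs_ringChoose_le_one h0 h1 (m + 1)
    calc _ ≤ 1 * (‖z‖ ^ m * ‖z‖) := by gcongr
      _ = _ := by ring
  · have h2 : (1 - ‖z‖)⁻¹ ≤ 2 := by
      rw [inv_le_comm₀ (by linarith) (by norm_num)]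
      linarith
    nlinarith [norm_nonneg z]

theorem half_pow_le_or {J x y : ℝ} (hJ : 0 ≤ J) (h : J ≤ x + y) (r : ℕ) :
    (J / 2) ^ r ≤ x ^ r ∨ (J / 2) ^ r ≤ y ^ r := by
  rcases le_total x y with hxy | hxy
  · right
    exact pow_le_pow_left₀ (by linarith) (by linarith) r
  · left
    exact pow_le_pow_left₀ (by linarith) (by linarith) r

namespace Diagonal

variable {r : ℕ} {F : MvPolynomial (Fin 2) ℤ} (d : Diagonal r F) {h : ℤ}

/-- The size of an integer point. -/
noncomputable def size (p : ℤ × ℤ) : ℝ := ‖d.xi p‖ ^ r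

/-- The quantity `(|j| / 2) ^ r`, where `j` is the determinant of the diagonalization. -/
noncomputable def weight : ℝ := (‖d.det‖ / 2) ^ r

/-- The point `p` is close to the zero of `F` attached to the root of unity `ω`. -/
structure IsRelated (h : ℤ) (ω : ℂ) (p : ℤ × ℤ) (w : ℂ) : Prop where
  root : ω ^ r = 1
  mem : p ∈ primitiveSolutions F h
  size_pos : 0 < d.size p
  eta_eq : d.eta p = ω * (1 + w) ^ (1 / r : ℂ) * d.xi p
  ne_zero : w ≠ 0
  norm_le : ‖w‖ ≤ h / d.size p
  le_half : (h : ℝ) / d.size p ≤ 1 / 2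
  eta_pow : d.eta p ^ r = (1 + w) * d.xi p ^ r

theorem norm_eval_le {p : ℤ × ℤ} (hp : p ∈ primitiveSolutions F h) :
    ‖d.xi p ^ r - d.eta p ^ r‖ ≤ h := by
  rw [← d.eval_eq, Complex.norm_intCast]
  exact_mod_cast hp.2.2

theorem norm_eta_pow_le {p : ℤ × ℤ} (hp : p ∈ primitiveSolutions F h) :
    ‖d.eta p‖ ^ r ≤ d.size p + h := by
  have h1 := d.norm_eval_le hp
  have h2 := norm_sub_le (d.xi p ^ r) (d.xi p ^ r - d.eta p ^ r)
  rw [sub_sub_cancel, norm_pow, norm_pow] at h2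
  rw [size]
  linarith

theorem norm_det_le_of_ne {p q : ℤ × ℤ} (hp : p ∈ primitiveSolutions F h)
    (hq : q ∈ primitiveSolutions F h) (hne : q ≠ p) (hne' : q ≠ -p) :
    ‖d.det‖ ≤ ‖d.xi p * d.eta q - d.xi q * d.eta p‖ := by
  rw [xi_mul_eta_sub, norm_mul, Complex.norm_intCast]
  have h0 : p.1 * q.2 - q.1 * p.2 ≠ 0 := by
    intro h0
    rcases eq_or_eq_neg_of_det_eq_zero hp.1 hq.1 h0 with h1 | h1
    · exact hne h1
    · exact hne' h1
  have h1 : (1 : ℝ) ≤ |((p.1 * q.2 - q.1 * p.2 : ℤ) : ℝ)| := by exact_mod_cast Int.one_le_abs h0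
  nlinarith [norm_nonneg d.det]

theorem size_nonneg (p : ℤ × ℤ) : 0 ≤ d.size p := by unfold size; positivity

/-- Two essentially different solutions cannot both be small. -/
theorem eq_or_eq_neg_of_small (hr : 6 ≤ r) (hh : 0 < h)
    (hW : (r : ℝ) ^ 13 * (h : ℝ) ^ 6 ≤ d.weight) {p q : ℤ × ℤ}
    (hp : p ∈ primitiveSolutions F h) (hq : q ∈ primitiveSolutions F h)
    (hps : 2 * d.size p ^ 2 < d.weight) (hqs : 2 * d.size q ^ 2 < d.weight) :
    q = p ∨ q = -p := by
  by_contra! hne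
  have h1 := (d.norm_det_le_of_ne hp hq hne.1 hne.2).trans (norm_sub_le _ _)
  rw [norm_mul, norm_mul] at h1
  have hh1 : (1 : ℝ) ≤ h := by exact_mod_cast hh
  have hr6 : (6 : ℝ) ≤ r := by exact_mod_cast hr
  have hW2 : 2 * (h : ℝ) ^ 2 ≤ d.weight := by
    refine le_trans ?_ hW
    have e1 : (2 : ℝ) ≤ (r : ℝ) ^ 13 := by
      calc (2 : ℝ) ≤ 6 ^ 13 := by norm_num
        _ ≤ _ := by gcongr
    have e2 : (h : ℝ) ^ 2 ≤ (h : ℝ) ^ 6 := pow_le_pow_right₀ hh1 (by norm_num)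
    gcongr
  -- With sizes s, t the bound is s(t + h) ≤ (s² + t²)/2 + (s² + h²)/2 < W, since s², t² < W/2 and
  -- h² ≤ W/2.
  have key : ∀ p q : ℤ × ℤ, q ∈ primitiveSolutions F h → 2 * d.size p ^ 2 < d.weight →
      2 * d.size q ^ 2 < d.weight → (‖d.xi p‖ * ‖d.eta q‖) ^ r < d.weight := by
    intro p q hq hps hqs
    rw [mul_pow]
    calc ‖d.xi p‖ ^ r * ‖d.eta q‖ ^ r ≤ d.size p * (d.size q + h) :=
          mul_le_mul_of_nonneg_left (d.norm_eta_pow_le hq) (d.size_nonneg p)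
      _ < d.weight := by
          nlinarith [sq_nonneg (d.size p - d.size q), sq_nonneg (d.size p - h)]
  rcases half_pow_le_or (norm_nonneg _) h1 r with h2 | h2
  · exact absurd (key p q hq hps hqs) (not_lt.2 h2)
  · exact absurd (key q p hp hqs hps) (not_lt.2 h2)

theorem pow_mul_pow_le_size (hr : 6 ≤ r) (hh : 0 < h)
    (hW : (r : ℝ) ^ 13 * (h : ℝ) ^ 6 ≤ d.weight) {p : ℤ × ℤ}
    (hps : d.weight ≤ 2 * d.size p ^ 2) : (r : ℝ) ^ 6 * (h : ℝ) ^ 3 ≤ d.size p := by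
  have hh1 : (1 : ℝ) ≤ h := by exact_mod_cast hh
  have hr6 : (6 : ℝ) ≤ r := by exact_mod_cast hr
  refine le_of_sq_le_sq ?_ (d.size_nonneg p)
  have h1 : 0 ≤ (r : ℝ) ^ 12 * (h : ℝ) ^ 6 := by positivity
  nlinarith

/-- Take w = -F/ξ^r, so that η^r = (1 + w)ξ^r. Then ω is η/ξ divided by the principal root of 1 + w,
and w ≠ 0 because F does not vanish at the solution. -/
theorem exists_isRelated (hr : 6 ≤ r) (hh : 0 < h)
    (hW : (r : ℝ) ^ 13 * (h : ℝ) ^ 6 ≤ d.weight) {p : ℤ × ℤ}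
    (hp : p ∈ primitiveSolutions F h) (hps : d.weight ≤ 2 * d.size p ^ 2) :
    ∃ ω w, d.IsRelated h ω p w := by
  have hh1 : (1 : ℝ) ≤ h := by exact_mod_cast hh
  have hr6 : (6 : ℝ) ≤ r := by exact_mod_cast hr
  have hr0 : r ≠ 0 := by omega
  have hs := d.pow_mul_pow_le_size hr hh hW hps
  have hs2 : 2 * (h : ℝ) ≤ d.size p := by
    refine le_trans ?_ hs
    have e1 : (2 : ℝ) ≤ (r : ℝ) ^ 6 := by
      calc (2 : ℝ) ≤ 6 ^ 6 := by norm_num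
        _ ≤ _ := by gcongr
    have e2 : (h : ℝ) ≤ (h : ℝ) ^ 3 := le_self_pow₀ hh1 (by norm_num)
    gcongr
  have hpos : 0 < d.size p := by linarith
  have hxi : d.xi p ≠ 0 := by
    intro h0
    rw [size, h0, norm_zero, zero_pow hr0] at hpos
    exact lt_irrefl _ hpos
  have hhalf : (h : ℝ) / d.size p ≤ 1 / 2 := by
    rw [div_le_div_iff₀ hpos (by norm_num)]
    linarith
  set w : ℂ := -(d.xi p ^ r - d.eta p ^ r) / d.xi p ^ r with hw
  have hwn : ‖w‖ ≤ h / d.size p := by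
    rw [hw, norm_div, norm_neg, norm_pow (d.xi p), ← size]
    exact div_le_div_of_nonneg_right (d.norm_eval_le hp) hpos.le
  have hw1 : ‖w‖ < 1 := by linarith
  have hw0 : 1 + w ≠ 0 := by
    intro h0
    rw [show w = -1 by linear_combination h0] at hw1
    simp at hw1
  have heta : d.eta p ^ r = (1 + w) * d.xi p ^ r := by
    rw [hw]
    field_simp
    ring
  set ρ : ℂ := (1 + w) ^ (1 / r : ℂ) with hρ
  have hρr : ρ ^ r = 1 + w := by
    rw [hρ, one_div, Complex.cpow_nat_inv_pow _ hr0]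
  have hρ0 : ρ ≠ 0 := by
    intro h0
    rw [h0, zero_pow hr0] at hρr
    exact hw0 hρr.symm
  refine ⟨d.eta p / (ρ * d.xi p), w, ⟨?_, hp, hpos, ?_, ?_, hwn, hhalf, heta⟩⟩
  · rw [div_pow, mul_pow, hρr, heta, div_self (mul_ne_zero hw0 (pow_ne_zero r hxi))]
  · rw [← hρ]
    field_simp
  · rw [hw, ← d.eval_eq]
    refine div_ne_zero (neg_ne_zero.2 ?_) (pow_ne_zero r hxi)
    exact_mod_cast abs_pos.1 hp.2.1

variable {d}

namespace IsRelated

variable {ω w w' : ℂ} {p q : ℤ × ℤ}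

theorem xi_ne_zero (hr : r ≠ 0) (hp : d.IsRelated h ω p w) : d.xi p ≠ 0 := by
  intro h0
  have := hp.size_pos
  rw [size, h0, norm_zero, zero_pow hr] at this
  exact lt_irrefl _ this

theorem norm_root (hr : r ≠ 0) (hp : d.IsRelated h ω p w) : ‖ω‖ = 1 :=
  Complex.norm_eq_one_of_pow_eq_one hp.root hr

theorem norm_le_half (hp : d.IsRelated h ω p w) : ‖w‖ ≤ 1 / 2 := hp.norm_le.trans hp.le_half

theorem norm_sub_one_le (hr : 2 ≤ r) (hp : d.IsRelated h ω p w) :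
    ‖(1 + w) ^ (1 / r : ℂ) - 1‖ ≤ 2 * (h / d.size p) := by
  have hr' : (2 : ℚ) ≤ r := by exact_mod_cast hr
  have h1 := norm_one_add_cpow_sub_one_le (ν := 1 / r) (by positivity)
    (by rw [div_le_one (by linarith)]; linarith) hp.norm_le_half
  push_cast at h1
  linarith [hp.norm_le]

theorem cpow_ne_zero (hr : r ≠ 0) (hp : d.IsRelated h ω p w) : (1 + w) ^ (1 / r : ℂ) ≠ 0 := by
  intro h0
  have h1 : 1 + w = 0 := by
    rw [← Complex.cpow_nat_inv_pow (1 + w) hr, ← one_div, h0, zero_pow hr]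
  have h2 := hp.norm_le_half
  rw [show w = -1 by linear_combination h1] at h2
  norm_num at h2

/-- The gap principle. -/
theorem gap (hr : 2 ≤ r) (hh : 0 < h) (hp : d.IsRelated h ω p w) (hq : d.IsRelated h ω q w')
    (hne : q ≠ p) (hne' : q ≠ -p) (hle : d.size p ≤ d.size q) :
    d.weight * d.size p ^ (r - 1) ≤ d.size q * (2 * h) ^ r := by
  have hh1 : (0 : ℝ) < h := by exact_mod_cast hh
  have h1 := d.norm_det_le_of_ne hp.mem hq.mem hne hne'
  have hpos := hp.size_pos
  set ρ := (1 + w) ^ (1 / r : ℂ)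
  set ρ' := (1 + w') ^ (1 / r : ℂ)
  -- A common ω factors out, leaving a difference of two numbers close to 1.
  have e : d.xi p * d.eta q - d.xi q * d.eta p = d.xi p * d.xi q * ω * ((ρ' - 1) - (ρ - 1)) := by
    rw [hp.eta_eq, hq.eta_eq]
    ring
  have h2 : ‖(ρ' - 1) - (ρ - 1)‖ ≤ 4 * (h / d.size p) := by
    have h3 := hp.norm_sub_one_le hr
    have h4 := hq.norm_sub_one_le hr
    have h5 : (h : ℝ) / d.size q ≤ h / d.size p := div_le_div_of_nonneg_left hh1.le hpos hle
    exact (norm_sub_le _ _).trans (by linarith)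
  rw [e, norm_mul, norm_mul, norm_mul, hp.norm_root (by omega), mul_one] at h1
  have h3 : ‖d.det‖ / 2 ≤ ‖d.xi p‖ * ‖d.xi q‖ * (2 * h / d.size p) := by
    have := h1.trans (mul_le_mul_of_nonneg_left h2 (by positivity))
    have e2 : ‖d.xi p‖ * ‖d.xi q‖ * (4 * (h / d.size p)) =
        2 * (‖d.xi p‖ * ‖d.xi q‖ * (2 * h / d.size p)) := by ring
    linarith
  have h4 := pow_le_pow_left₀ (by positivity) h3 r
  rw [mul_pow, mul_pow, div_pow (2 * (h : ℝ)), ← size, ← size, ← mul_div_assoc,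
    le_div_iff₀ (by positivity)] at h4
  have h5 : d.size p ^ r = d.size p * d.size p ^ (r - 1) := by
    rw [← pow_succ', Nat.sub_add_cancel (by omega)]
  rw [h5] at h4
  rw [weight]
  refine le_of_mul_le_mul_left ?_ hpos
  linarith

/-- The r-th power of the Liouville bound against an upper bound. With ρ, ρ' the roots at p, q, one
splits ρ'P - ρQ = (ρ' - 1)P + (P - ρQ): the first term is small because q is large, the second is
the Padé remainder. -/
theorem approx (hr : 2 ≤ r) (hh : 0 < h) (hp : d.IsRelated h ω p w) (hq : d.IsRelated h ω q w')
    (n : ℕ) (c : ℕ → ℤ)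
    (hA : ∀ x : ℂ, ‖x‖ ≤ 2 →
      ‖∑ k ∈ Finset.range (n + 1), (c k : ℂ) * x ^ k‖ ≤ 2 * (8 * (r : ℝ) ^ 2) ^ n)
    (hR : ‖∑ k ∈ Finset.range (n + 1), (c k : ℂ) * (1 + w) ^ k -
        (1 + w) ^ (1 / r : ℂ) * ∑ k ∈ Finset.range (n + 1), (c (n - k) : ℂ) * (1 + w) ^ k‖ ≤
      8 * (8 * (r : ℝ) ^ 2) ^ n * ‖w‖ ^ (2 * n + 1))
    (hne : (1 + w') ^ (1 / r : ℂ) * ∑ k ∈ Finset.range (n + 1), (c k : ℂ) * (1 + w) ^ k ≠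
      (1 + w) ^ (1 / r : ℂ) * ∑ k ∈ Finset.range (n + 1), (c (n - k) : ℂ) * (1 + w) ^ k) :
    ‖d.det‖ ^ r ≤ ((8 * (r : ℝ) ^ 3 * ‖d.sqrtDisc‖) ^ r) ^ n * d.size p ^ (r * n + 1) * d.size q *
      (4 * (h / d.size q) + 8 * (h / d.size p) ^ (2 * n + 1)) ^ r := by
  have hr0 : r ≠ 0 := by omega
  have hh1 : (0 : ℝ) < h := by exact_mod_cast hh
  have hx := hp.xi_ne_zero hr0
  have hy := hq.xi_ne_zero hr0
  have hpos := hp.size_pos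
  have hpos' := hq.size_pos
  have hω := hp.norm_root hr0
  have hω0 : ω ≠ 0 := by rw [← norm_ne_zero_iff, hω]; exact one_ne_zero
  set ρ := (1 + w) ^ (1 / r : ℂ) with hρ
  set ρ' := (1 + w') ^ (1 / r : ℂ) with hρ'
  set x : ℂ := 1 + w with hxdef
  set P := ∑ k ∈ Finset.range (n + 1), (c k : ℂ) * x ^ k with hP
  set Q := ∑ k ∈ Finset.range (n + 1), (c (n - k) : ℂ) * x ^ k with hQ
  have s1 : ∑ k ∈ Finset.range (n + 1), (c k : ℂ) * ((d.xi p ^ r) ^ (n - k) * (d.eta p ^ r) ^ k) =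
      (d.xi p ^ r) ^ n * P := by
    rw [hP, Finset.mul_sum]
    refine Finset.sum_congr rfl fun k hk => ?_
    have hk' : (d.xi p ^ r) ^ n = (d.xi p ^ r) ^ (n - k) * (d.xi p ^ r) ^ k := by
      rw [← pow_add, Nat.sub_add_cancel (Nat.lt_succ_iff.1 (Finset.mem_range.1 hk))]
    rw [hp.eta_pow, mul_pow, hk']
    ring
  have s2 : ∑ k ∈ Finset.range (n + 1), (c k : ℂ) * ((d.eta p ^ r) ^ (n - k) * (d.xi p ^ r) ^ k) =
      (d.xi p ^ r) ^ n * Q := by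
    rw [hQ, Finset.mul_sum, ← Finset.sum_range_reflect]
    refine Finset.sum_congr rfl fun k hk => ?_
    have hk1 : k ≤ n := Nat.lt_succ_iff.1 (Finset.mem_range.1 hk)
    have hk' : (d.xi p ^ r) ^ n = (d.xi p ^ r) ^ (n - k) * (d.xi p ^ r) ^ k := by
      rw [← pow_add, Nat.sub_add_cancel hk1]
    rw [show n + 1 - 1 - k = n - k by omega, Nat.sub_sub_self hk1, hp.eta_pow, mul_pow, hk']
    ring
  have e : d.xi p * d.eta q * ((d.xi p ^ r) ^ n * P) - d.xi q * d.eta p * ((d.xi p ^ r) ^ n * Q) =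
      d.xi p * d.xi q * ω * (d.xi p ^ r) ^ n * (ρ' * P - ρ * Q) := by
    rw [hp.eta_eq, hq.eta_eq]
    ring
  have h1 := d.norm_det_le (by omega) n c p q (by
    rw [s1, s2, ← sub_ne_zero, e]
    exact mul_ne_zero (mul_ne_zero (mul_ne_zero (mul_ne_zero hx hy) hω0)
      (pow_ne_zero _ (pow_ne_zero _ hx))) (sub_ne_zero.2 hne))
  rw [s1, s2, e, norm_mul, norm_mul, norm_mul, norm_mul, hω, mul_one, norm_pow, norm_pow,
    ← size] at h1
  have h2 : ‖ρ' * P - ρ * Q‖ ≤ (8 * (r : ℝ) ^ 2) ^ n *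
      (4 * (h / d.size q) + 8 * (h / d.size p) ^ (2 * n + 1)) := by
    have e2 : ρ' * P - ρ * Q = (ρ' - 1) * P + (P - ρ * Q) := by ring
    have b1 := hq.norm_sub_one_le hr
    have b2 : ‖P‖ ≤ 2 * (8 * (r : ℝ) ^ 2) ^ n := by
      refine hA x ?_
      have := norm_add_le 1 w
      rw [norm_one] at this
      linarith [hp.norm_le_half]
    have b3 : ‖P - ρ * Q‖ ≤ 8 * (8 * (r : ℝ) ^ 2) ^ n * (h / d.size p) ^ (2 * n + 1) := by
      refine hR.trans ?_
      gcongr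
      exact hp.norm_le
    rw [e2]
    refine (norm_add_le _ _).trans ?_
    rw [norm_mul]
    calc _ ≤ 2 * (h / d.size q) * (2 * (8 * (r : ℝ) ^ 2) ^ n) +
          8 * (8 * (r : ℝ) ^ 2) ^ n * (h / d.size p) ^ (2 * n + 1) := by
          refine add_le_add (mul_le_mul b1 b2 (norm_nonneg _) (by positivity)) b3
      _ = _ := by ring
  have h3 : ‖d.det‖ ≤ (r * ‖d.sqrtDisc‖) ^ n * (‖d.xi p‖ * ‖d.xi q‖ * d.size p ^ n *
      ((8 * (r : ℝ) ^ 2) ^ n * (4 * (h / d.size q) + 8 * (h / d.size p) ^ (2 * n + 1)))) := by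
    refine h1.trans ?_
    gcongr
  set B := 4 * (h / d.size q) + 8 * (h / d.size p) ^ (2 * n + 1)
  have e3 : (r * ‖d.sqrtDisc‖) ^ n * (‖d.xi p‖ * ‖d.xi q‖ * d.size p ^ n *
      ((8 * (r : ℝ) ^ 2) ^ n * B)) = (8 * (r : ℝ) ^ 3 * ‖d.sqrtDisc‖) ^ n * ‖d.xi p‖ * ‖d.xi q‖ *
      d.size p ^ n * B := by
    rw [show 8 * (r : ℝ) ^ 3 * ‖d.sqrtDisc‖ = (r * ‖d.sqrtDisc‖) * (8 * (r : ℝ) ^ 2) by ring,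
      mul_pow (r * ‖d.sqrtDisc‖)]
    ring
  rw [e3] at h3
  refine (pow_le_pow_left₀ (norm_nonneg _) h3 r).trans (le_of_eq ?_)
  rw [mul_pow, mul_pow, mul_pow, mul_pow, ← size, ← size, ← pow_mul, ← pow_mul, ← pow_mul,
    mul_comm n r, pow_succ]
  ring

end IsRelated

end Diagonal

end Solutions

/-! ### Excluding three large solutions attached to one root of unity. -/

section Descent

/-- By induction V ≥ T^(4n+8) for every n, which is absurd. With m ≤ n + 2 the first alternative
contradicts the bound already reached, as 4(n+2)(r-1) exceeds (2r+3)(n+2) + 3; the second gives the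
next bound. -/
theorem false_of_windows {r : ℕ} (hr : 6 ≤ r) {T V : ℝ} (hT : 2 ≤ T)
    (hV : T ^ (2 * r - 3) ≤ V)
    (hstep : ∀ n : ℕ, ∃ m, (m = n ∨ m = n + 1) ∧
      (V ^ (r - 1) ≤ T ^ ((2 * r + 3) * m + 3) ∨ T ^ ((2 * r - 5) * m + (2 * r - 3)) ≤ V)) :
    False := by
  have hT1 : 1 < T := by linarith
  have hind : ∀ n : ℕ, T ^ (4 * n + 8) ≤ V := by
    intro n
    induction n with
    | zero => exact (pow_le_pow_right₀ hT1.le (by omega)).trans hV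
    | succ n ih =>
      obtain ⟨m, hm, h | h⟩ := hstep (n + 1)
      · exfalso
        have h1 : T ^ ((4 * n + 8) * (r - 1)) ≤ T ^ ((2 * r + 3) * m + 3) := by
          rw [pow_mul]
          exact (pow_le_pow_left₀ (by positivity) ih _).trans h
        have h2 := (pow_le_pow_iff_right₀ hT1).1 h1
        obtain ⟨s, rfl⟩ : ∃ s, r = s + 6 := ⟨r - 6, by omega⟩
        rw [show s + 6 - 1 = s + 5 by omega] at h2
        have hm2 : m ≤ n + 2 := by omega
        nlinarith
      · refine (pow_le_pow_right₀ hT1.le ?_).trans h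
        have hm1 : n + 1 ≤ m := by omega
        obtain ⟨s, rfl⟩ : ∃ s, r = s + 6 := ⟨r - 6, by omega⟩
        rw [show 2 * (s + 6) - 5 = 2 * s + 7 by omega, show 2 * (s + 6) - 3 = 2 * s + 9 by omega]
        nlinarith
  obtain ⟨n, hn⟩ := pow_unbounded_of_one_lt V hT1
  have h1 := hind n
  have h2 : T ^ n ≤ T ^ (4 * n + 8) := pow_le_pow_right₀ hT1.le (by omega)
  linarith

/-- Here T² and V are the sizes of the two larger points. The alternatives correspond to which
summand dominates; one factor T absorbs (8H)^r, and T^(2m+1) absorbs the constants in the other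
case. -/
theorem window_of_approx {r : ℕ} (hr : 6 ≤ r) {T V G H J : ℝ} (hT : 1 ≤ T) (hV : 0 < V)
    (hG0 : 0 ≤ G) (hG : G ≤ T ^ 3) (hH : 1 ≤ H) (hHT : 16 ^ r * H ^ r ≤ T) (hJ : 1 ≤ J) (m : ℕ)
    (h : J ≤ G ^ m * (T ^ 2) ^ (r * m + 1) * V *
      (4 * (H / V) + 8 * (H / T ^ 2) ^ (2 * m + 1)) ^ r) :
    V ^ (r - 1) ≤ T ^ ((2 * r + 3) * m + 3) ∨ T ^ ((2 * r - 5) * m + (2 * r - 3)) ≤ V := by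
  have hT0 : 0 < T := by linarith
  have hGm : G ^ m ≤ T ^ (3 * m) := by rw [pow_mul]; exact pow_le_pow_left₀ hG0 hG m
  have hbase : ∀ B : ℝ, 0 ≤ B → 4 * (H / V) + 8 * (H / T ^ 2) ^ (2 * m + 1) ≤ B →
      1 ≤ T ^ (3 * m + 2 * (r * m + 1)) * V * B ^ r := by
    intro B hB hle
    calc 1 ≤ J := hJ
      _ ≤ _ := h
      _ ≤ T ^ (3 * m) * (T ^ 2) ^ (r * m + 1) * V * B ^ r := by gcongr
      _ = _ := by rw [← pow_mul, ← pow_add]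
  rcases le_total (8 * (H / T ^ 2) ^ (2 * m + 1)) (4 * (H / V)) with hc | hc
  · left
    have h1 := hbase (8 * H / V) (by positivity) (by
      have : 8 * H / V = 4 * (H / V) + 4 * (H / V) := by ring
      linarith)
    rw [div_pow, ← mul_div_assoc, le_div_iff₀ (by positivity), one_mul] at h1
    have h2 : (8 * H) ^ r ≤ T := by
      refine le_trans ?_ hHT
      rw [← mul_pow]
      gcongr
      norm_num
    have h3 : V ^ r = V * V ^ (r - 1) := by rw [← pow_succ', Nat.sub_add_cancel (by omega)]
    have h4 : V * V ^ (r - 1) ≤ V * T ^ ((2 * r + 3) * m + 3) := by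
      rw [← h3]
      calc V ^ r ≤ T ^ (3 * m + 2 * (r * m + 1)) * V * (8 * H) ^ r := h1
        _ ≤ T ^ (3 * m + 2 * (r * m + 1)) * V * T := by gcongr
        _ = V * T ^ (3 * m + 2 * (r * m + 1) + 1) := by rw [pow_succ]; ring
        _ = _ := by congr 2; ring
    exact le_of_mul_le_mul_left h4 hV
  · right
    have h1 := hbase (16 * (H / T ^ 2) ^ (2 * m + 1)) (by positivity) (by linarith)
    rw [mul_pow, ← pow_mul, div_pow, ← pow_mul, ← mul_div_assoc, ← mul_div_assoc,
      le_div_iff₀ (by positivity), one_mul] at h1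
    have h2 : 16 ^ r * H ^ ((2 * m + 1) * r) ≤ T ^ (2 * m + 1) := by
      calc 16 ^ r * H ^ ((2 * m + 1) * r) ≤ (16 ^ r) ^ (2 * m + 1) * H ^ ((2 * m + 1) * r) := by
            gcongr
            exact le_self_pow₀ (one_le_pow₀ (by norm_num)) (by omega)
        _ = (16 ^ r * H ^ r) ^ (2 * m + 1) := by rw [mul_pow, ← pow_mul H, mul_comm r]
        _ ≤ _ := by gcongr
    have h3 : T ^ (2 * ((2 * m + 1) * r)) ≤ T ^ (3 * m + 2 * (r * m + 1) + (2 * m + 1)) * V := by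
      calc _ ≤ T ^ (3 * m + 2 * (r * m + 1)) * V * (16 ^ r * H ^ ((2 * m + 1) * r)) := h1
        _ ≤ T ^ (3 * m + 2 * (r * m + 1)) * V * T ^ (2 * m + 1) := by gcongr
        _ = _ := by rw [pow_add T (3 * m + 2 * (r * m + 1))]; ring
    have h4 : 2 * ((2 * m + 1) * r) =
        (3 * m + 2 * (r * m + 1) + (2 * m + 1)) + ((2 * r - 5) * m + (2 * r - 3)) := by
      obtain ⟨s, rfl⟩ : ∃ s, r = s + 6 := ⟨r - 6, by omega⟩
      rw [show 2 * (s + 6) - 5 = 2 * s + 7 by omega, show 2 * (s + 6) - 3 = 2 * s + 9 by omega]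
      ring
    rw [h4, pow_add] at h3
    exact le_of_mul_le_mul_left h3 (by positivity)

namespace Diagonal

variable {r : ℕ} {F : MvPolynomial (Fin 2) ℤ} {d : Diagonal r F} {h : ℤ} {ω : ℂ}

theorem weight_eq (d : Diagonal r F) : ‖d.det‖ ^ r = 2 ^ r * d.weight := by
  rw [weight, ← mul_pow]
  congr 1
  ring

/-- G = (8r³|sqrtDisc|)^r is the growth factor of the Padé inequality. The bound on sqrtDisc is used
as |sqrtDisc|^(2r) ≤ |sqrtDisc|^(3(r-2)), valid since r ≥ 6. -/
theorem sq_growth_le (hr : 6 ≤ r) (d : Diagonal r F) :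
    ((8 * (r : ℝ) ^ 3 * ‖d.sqrtDisc‖) ^ r) ^ 2 ≤ 512 ^ r * (r : ℝ) ^ (6 * r + 6) * d.weight ^ 3 := by
  have h1 := d.norm_sqrtDisc_pow_le (by omega)
  rw [weight_eq] at h1
  have h2 : ‖d.sqrtDisc‖ ^ (2 * r) ≤ ((r : ℝ) ^ 2 * (2 ^ r * d.weight)) ^ 3 := by
    calc ‖d.sqrtDisc‖ ^ (2 * r) ≤ ‖d.sqrtDisc‖ ^ ((r - 2) * 3) :=
          pow_le_pow_right₀ d.one_le_norm_sqrtDisc (by omega)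
      _ ≤ _ := by rw [pow_mul]; gcongr
  calc ((8 * (r : ℝ) ^ 3 * ‖d.sqrtDisc‖) ^ r) ^ 2 =
        64 ^ r * (r : ℝ) ^ (6 * r) * ‖d.sqrtDisc‖ ^ (2 * r) := by
        rw [show (64 : ℝ) = 8 ^ 2 by norm_num, mul_pow, mul_pow, mul_pow, mul_pow]
        simp only [← pow_mul]
        congr 1
        · congr 2 <;> ring
        · congr 1; ring
    _ ≤ 64 ^ r * (r : ℝ) ^ (6 * r) * ((r : ℝ) ^ 2 * (2 ^ r * d.weight)) ^ 3 := by gcongr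
    _ = _ := by
        rw [show (512 : ℝ) = 64 * 2 ^ 3 by norm_num, mul_pow 64, pow_add]
        simp only [mul_pow, ← pow_mul]
        rw [mul_comm 3 r]
        ring

/-- Cube the gap inequality and split the exponent 3(r-1) of U₁ as r + (2r-3): the first part
cancels the powers of H, the second dominates 4096^r r^6. Combined with `sq_growth_le` this gives G²
≤ U³. -/
theorem size_cube_ge (hr : 6 ≤ r) {U U₁ W H : ℝ} (hH : 1 ≤ H) (hW : 0 ≤ W)
    (hU₁ : (r : ℝ) ^ 6 * H ^ 3 ≤ U₁) (hgap : W * U₁ ^ (r - 1) ≤ U * (2 * H) ^ r) :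
    512 ^ r * (r : ℝ) ^ (6 * r + 6) * W ^ 3 ≤ U ^ 3 := by
  have hr6 : (6 : ℝ) ≤ r := by exact_mod_cast hr
  have hr0 : (0 : ℝ) < r := by linarith
  have hU₁0 : 0 < U₁ := lt_of_lt_of_le (by positivity) hU₁
  have h1 : W ^ 3 * U₁ ^ ((r - 1) * 3) ≤ U ^ 3 * (8 ^ r * (H ^ 3) ^ r) := by
    have := pow_le_pow_left₀ (by positivity) hgap 3
    rw [mul_pow, ← pow_mul, mul_pow] at this
    refine this.trans (le_of_eq ?_)
    rw [show (8 : ℝ) = 2 ^ 3 by norm_num, ← mul_pow (2 ^ 3), ← mul_pow 2 H 3, ← pow_mul, ← pow_mul,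
      mul_comm r]
  have hU0 : 0 ≤ U ^ 3 := by
    by_contra! hneg
    have : 0 ≤ W ^ 3 * U₁ ^ ((r - 1) * 3) := by positivity
    have h8 : 0 < (8 : ℝ) ^ r * (H ^ 3) ^ r := by positivity
    nlinarith
  have hexp : (r - 1) * 3 = r + (2 * r - 3) := by omega
  rw [hexp, pow_add] at h1
  have h2 : (r : ℝ) ^ (6 * r) * (H ^ 3) ^ r ≤ U₁ ^ r := by
    rw [pow_mul, ← mul_pow]
    gcongr
  have h3 : (r : ℝ) ^ (6 * (2 * r - 3)) ≤ U₁ ^ (2 * r - 3) := by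
    rw [pow_mul]
    refine pow_le_pow_left₀ (by positivity) (le_trans ?_ hU₁) _
    exact le_mul_of_one_le_right (by positivity) (one_le_pow₀ hH)
  have h4 : W ^ 3 * ((r : ℝ) ^ (6 * r) * (H ^ 3) ^ r * (r : ℝ) ^ (6 * (2 * r - 3))) ≤
      U ^ 3 * (8 ^ r * (H ^ 3) ^ r) := by
    refine le_trans ?_ h1
    gcongr
  have h5 : W ^ 3 * ((r : ℝ) ^ (6 * r) * (r : ℝ) ^ (6 * (2 * r - 3))) ≤ U ^ 3 * 8 ^ r := by
    have hHr : 0 < (H ^ 3) ^ r := by positivity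
    refine le_of_mul_le_mul_right ?_ hHr
    linarith
  have h6 : (4096 : ℝ) ^ r * (r : ℝ) ^ (6 * r + 6) ≤
      (r : ℝ) ^ (6 * r) * (r : ℝ) ^ (6 * (2 * r - 3)) := by
    calc (4096 : ℝ) ^ r * (r : ℝ) ^ (6 * r + 6) ≤ ((r : ℝ) ^ 5) ^ r * (r : ℝ) ^ (6 * r + 6) := by
          gcongr
          calc (4096 : ℝ) ≤ 6 ^ 5 := by norm_num
            _ ≤ _ := by gcongr
      _ = (r : ℝ) ^ (5 * r + (6 * r + 6)) := by rw [← pow_mul, ← pow_add]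
      _ ≤ (r : ℝ) ^ (6 * r + 6 * (2 * r - 3)) := pow_le_pow_right₀ (by linarith) (by omega)
      _ = _ := by rw [pow_add]
  have h7 : (4096 : ℝ) ^ r = 512 ^ r * 8 ^ r := by rw [← mul_pow]; norm_num
  rw [h7] at h6
  have h8 : (0 : ℝ) < 8 ^ r := by positivity
  refine le_of_mul_le_mul_right ?_ h8
  calc 512 ^ r * (r : ℝ) ^ (6 * r + 6) * W ^ 3 * 8 ^ r =
        W ^ 3 * (512 ^ r * 8 ^ r * (r : ℝ) ^ (6 * r + 6)) := by ring
    _ ≤ _ := mul_le_mul_of_nonneg_left h6 (by positivity)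
    _ ≤ _ := h5

/-- Both W and U₁ are at least r^6 H³, so the gap inequality gives (r^6 H²/2)^r ≤ U, and 16² ≤
r^6/2. -/
theorem size_ge (hr : 6 ≤ r) {U U₁ W H : ℝ} (hH : 1 ≤ H) (hW : (r : ℝ) ^ 13 * H ^ 6 ≤ W)
    (hU₁ : (r : ℝ) ^ 6 * H ^ 3 ≤ U₁) (hgap : W * U₁ ^ (r - 1) ≤ U * (2 * H) ^ r) :
    (16 ^ r * H ^ r) ^ 2 ≤ U := by
  have hr6 : (6 : ℝ) ≤ r := by exact_mod_cast hr
  have hr0 : (0 : ℝ) < r := by linarith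
  have h1 : ((r : ℝ) ^ 6 * H ^ 3) ^ r ≤ U * (2 * H) ^ r := by
    refine le_trans ?_ hgap
    calc ((r : ℝ) ^ 6 * H ^ 3) ^ r = ((r : ℝ) ^ 6 * H ^ 3) * ((r : ℝ) ^ 6 * H ^ 3) ^ (r - 1) := by
          rw [← pow_succ', Nat.sub_add_cancel (by omega)]
      _ ≤ W * U₁ ^ (r - 1) := by
          gcongr
          · exact le_trans (by positivity) hW
          · refine le_trans ?_ hW
            gcongr <;> linarith
  have h2 : ((r : ℝ) ^ 6 * H ^ 3) = ((r : ℝ) ^ 6 / 2 * H ^ 2) * (2 * H) := by ring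
  rw [h2, mul_pow] at h1
  have h3 := le_of_mul_le_mul_right h1 (by positivity)
  refine le_trans ?_ h3
  rw [← mul_pow, ← pow_mul, mul_comm r 2, pow_mul]
  refine pow_le_pow_left₀ (by positivity) ?_ r
  rw [mul_pow]
  gcongr
  calc (16 : ℝ) ^ 2 ≤ 6 ^ 6 / 2 := by norm_num
    _ ≤ _ := by gcongr

/-- At most two essentially different large solutions are related to a given root of unity. -/
theorem false_of_three_related (hr : 6 ≤ r) (hh : 0 < h)
    (hW : (r : ℝ) ^ 13 * (h : ℝ) ^ 6 ≤ d.weight) {p₁ p₂ p₃ : ℤ × ℤ} {w₁ w₂ w₃ : ℂ}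
    (h₁ : d.IsRelated h ω p₁ w₁) (h₂ : d.IsRelated h ω p₂ w₂) (h₃ : d.IsRelated h ω p₃ w₃)
    (hs : d.weight ≤ 2 * d.size p₁ ^ 2) (h12 : p₂ ≠ p₁) (h12' : p₂ ≠ -p₁) (h23 : p₃ ≠ p₂)
    (h23' : p₃ ≠ -p₂) (hle : d.size p₁ ≤ d.size p₂) (hle' : d.size p₂ ≤ d.size p₃) : False := by
  have hh1 : (1 : ℝ) ≤ h := by exact_mod_cast hh
  have hr6 : (6 : ℝ) ≤ r := by exact_mod_cast hr
  have hr2 : 2 ≤ r := by omega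
  have hW1 : 1 ≤ d.weight := by
    refine le_trans ?_ hW
    exact one_le_mul_of_one_le_of_one_le (one_le_pow₀ (by linarith)) (one_le_pow₀ hh1)
  have hgap := h₁.gap hr2 hh h₂ h12 h12' hle
  have hgap' := h₂.gap hr2 hh h₃ h23 h23' hle'
  have hU₁ := d.pow_mul_pow_le_size hr hh hW hs
  have hU := size_ge hr hh1 hW hU₁ hgap
  have hG := (d.sq_growth_le hr).trans (size_cube_ge hr hh1 (by linarith) hU₁ hgap)
  set G := (8 * (r : ℝ) ^ 3 * ‖d.sqrtDisc‖) ^ r with hGdef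
  set T := √(d.size p₂) with hTdef
  have hT2 : T ^ 2 = d.size p₂ := Real.sq_sqrt (d.size_nonneg _)
  have hT0 : 0 ≤ T := Real.sqrt_nonneg _
  have hHT : 16 ^ r * (h : ℝ) ^ r ≤ T := Real.le_sqrt_of_sq_le hU
  have hGT : G ≤ T ^ 3 := by
    refine le_of_sq_le_sq (hG.trans (le_of_eq ?_)) (by positivity)
    rw [← hT2]
    ring
  have hT16 : 16 ≤ T := by
    refine le_trans ?_ hHT
    calc (16 : ℝ) = 16 ^ 1 * 1 := by norm_num
      _ ≤ 16 ^ r * (h : ℝ) ^ r := by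
        gcongr
        · norm_num
        · omega
        · exact one_le_pow₀ hh1
  -- The gap between the two larger points starts the induction; one factor T is spent on (2h)^r.
  have hV0 : T ^ (2 * r - 3) ≤ d.size p₃ := by
    have e1 : (2 * (h : ℝ)) ^ r ≤ T := by
      refine le_trans ?_ hHT
      rw [← mul_pow]
      gcongr
      norm_num
    have e2 : T ^ (2 * r - 3) * T ≤ d.size p₃ * T := by
      calc T ^ (2 * r - 3) * T = 1 * (T ^ 2) ^ (r - 1) := by
            rw [← pow_succ, ← pow_mul, one_mul]
            congr 1
            omega
        _ ≤ d.weight * d.size p₂ ^ (r - 1) := by rw [hT2]; gcongr; exact pow_nonneg (d.size_nonneg _) _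
        _ ≤ d.size p₃ * (2 * h) ^ r := hgap'
        _ ≤ d.size p₃ * T := by gcongr; exact d.size_nonneg _
    exact le_of_mul_le_mul_right e2 (by linarith)
  obtain ⟨c, hA, hR, hdet⟩ := exists_integral_pade hr2
  refine false_of_windows hr (by linarith) hV0 fun n => ?_
  have hwin : ∀ m : ℕ, (1 + w₃) ^ (1 / r : ℂ) *
      ∑ k ∈ Finset.range (m + 1), (c m k : ℂ) * (1 + w₂) ^ k ≠
      (1 + w₂) ^ (1 / r : ℂ) * ∑ k ∈ Finset.range (m + 1), (c m (m - k) : ℂ) * (1 + w₂) ^ k →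
      (d.size p₃ ^ (r - 1) ≤ T ^ ((2 * r + 3) * m + 3) ∨
        T ^ ((2 * r - 5) * m + (2 * r - 3)) ≤ d.size p₃) := by
    intro m hne
    have happ := h₂.approx hr2 hh h₃ m (c m) (hA m) (hR m w₂ h₂.norm_le_half) hne
    rw [← hGdef, ← hT2] at happ
    refine window_of_approx hr (by linarith) h₃.size_pos (by positivity) hGT hh1 hHT ?_ m happ
    rw [weight_eq]
    exact one_le_mul_of_one_le_of_one_le (one_le_pow₀ (by norm_num)) hW1
  -- Equality at both n and n + 1 would make the Padé determinant vanish at 1 + w₂ ≠ 1, so one of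
  -- the two indices gives an inequality.
  by_cases hn : (1 + w₃) ^ (1 / r : ℂ) *
      ∑ k ∈ Finset.range (n + 1), (c n k : ℂ) * (1 + w₂) ^ k =
      (1 + w₂) ^ (1 / r : ℂ) * ∑ k ∈ Finset.range (n + 1), (c n (n - k) : ℂ) * (1 + w₂) ^ k
  · refine ⟨n + 1, Or.inr rfl, hwin (n + 1) fun hn' => ?_⟩
    have hx : 1 + w₂ ≠ 1 := fun hx => h₂.ne_zero (by linear_combination hx)
    refine hdet n (1 + w₂) hx ?_
    have hρ := mul_ne_zero (h₃.cpow_ne_zero (by omega)) (h₂.cpow_ne_zero (by omega))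
    apply mul_left_cancel₀ hρ
    linear_combination (1 + w₂) ^ (1 / r : ℂ) * (∑ k ∈ Finset.range (n + 1 + 1),
      (c (n + 1) (n + 1 - k) : ℂ) * (1 + w₂) ^ k) * hn - (1 + w₂) ^ (1 / r : ℂ) *
      (∑ k ∈ Finset.range (n + 1), (c n (n - k) : ℂ) * (1 + w₂) ^ k) * hn'
  · exact ⟨n, Or.inl rfl, hwin n hn⟩

end Diagonal

end Descent

/-! ### Counting by roots of unity, with the reality argument for positive discriminant. -/

section Counting

theorem encard_le_two_of_forall {α : Type*} {s : Set α}
    (h : ∀ x ∈ s, ∀ y ∈ s, ∀ z ∈ s, x ≠ y → x ≠ z → y ≠ z → False) : s.encard ≤ 2 := by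
  by_contra! hlt
  obtain ⟨t, hts, ht⟩ := Set.exists_subset_encard_eq (s := s) (k := 3) (by
    have := Order.add_one_le_of_lt hlt
    norm_num at this
    exact this)
  obtain ⟨x, y, z, hxy, hxz, hyz, rfl⟩ := Set.encard_eq_three.1 ht
  exact h x (hts (by simp)) y (hts (by simp)) z (hts (by simp)) hxy hxz hyz

theorem encard_biUnion_le_two_mul {ι α : Type*} (t : Finset ι) (B : ι → Set α)
    (hB : ∀ i, (B i).encard ≤ 2) : (⋃ i ∈ t, B i).encard ≤ 2 * t.card := by
  classical
  induction t using Finset.induction_on with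
  | empty => simp
  | insert i t hi ih =>
    rw [Finset.set_biUnion_insert, Finset.card_insert_of_notMem hi]
    refine (Set.encard_union_le _ _).trans ((add_le_add (hB i) ih).trans (le_of_eq ?_))
    push_cast
    ring

theorem sym2_neg_eq_iff {p q : ℤ × ℤ} : s(p, -p) = s(q, -q) ↔ q = p ∨ q = -p := by
  rw [Sym2.eq_iff]
  constructor
  · rintro (⟨h, -⟩ | ⟨h, -⟩)
    · exact Or.inl h.symm
    · right; rw [h, neg_neg]
  · rintro (rfl | rfl) <;> simp

theorem numSolutions_le_one {F : MvPolynomial (Fin 2) ℤ} {h : ℤ}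
    (H : ∀ p ∈ primitiveSolutions F h, ∀ q ∈ primitiveSolutions F h, q = p ∨ q = -p) :
    numSolutions F h ≤ 1 := by
  rw [numSolutions, Set.encard_le_one_iff]
  rintro _ _ ⟨p, hp, rfl⟩ ⟨q, hq, rfl⟩
  exact sym2_neg_eq_iff.2 (H p hp q hq)

namespace Diagonal

variable {r : ℕ} {F : MvPolynomial (Fin 2) ℤ} {d : Diagonal r F} {h : ℤ}

theorem encard_related_le_two (hr : 6 ≤ r) (hh : 0 < h)
    (hW : (r : ℝ) ^ 13 * (h : ℝ) ^ 6 ≤ d.weight) (ω : ℂ) :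
    ((fun p : ℤ × ℤ => s(p, -p)) ''
      {p | d.weight ≤ 2 * d.size p ^ 2 ∧ ∃ w, d.IsRelated h ω p w}).encard ≤ 2 := by
  apply encard_le_two_of_forall
  rintro _ ⟨p, ⟨hp, wp, hp'⟩, rfl⟩ _ ⟨q, ⟨hq, wq, hq'⟩, rfl⟩ _ ⟨t, ⟨ht, wt, ht'⟩, rfl⟩ h1 h2 h3
  rw [Ne, sym2_neg_eq_iff, not_or] at h1 h2 h3
  have h1' : p ≠ q ∧ p ≠ -q := ⟨Ne.symm h1.1, fun e => h1.2 (by rw [e, neg_neg])⟩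
  have h2' : p ≠ t ∧ p ≠ -t := ⟨Ne.symm h2.1, fun e => h2.2 (by rw [e, neg_neg])⟩
  have h3' : q ≠ t ∧ q ≠ -t := ⟨Ne.symm h3.1, fun e => h3.2 (by rw [e, neg_neg])⟩
  have key : ∀ {p₁ p₂ p₃ : ℤ × ℤ} {w₁ w₂ w₃ : ℂ}, d.IsRelated h ω p₁ w₁ → d.IsRelated h ω p₂ w₂ →
      d.IsRelated h ω p₃ w₃ → d.weight ≤ 2 * d.size p₁ ^ 2 → p₂ ≠ p₁ ∧ p₂ ≠ -p₁ →
      p₃ ≠ p₂ ∧ p₃ ≠ -p₂ → d.size p₁ ≤ d.size p₂ → d.size p₂ ≤ d.size p₃ → False :=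
    fun a b c e f g i j => false_of_three_related hr hh hW a b c e f.1 f.2 g.1 g.2 i j
  rcases le_total (d.size p) (d.size q) with a | a <;>
  rcases le_total (d.size q) (d.size t) with b | b <;>
  rcases le_total (d.size p) (d.size t) with c | c
  · exact key hp' hq' ht' hp h1 h3 a b
  · exact key hp' hq' ht' hp h1 h3 a b
  · exact key hp' ht' hq' hp h2 h3' c b
  · exact key ht' hp' hq' ht h2' h1 c a
  · exact key hq' hp' ht' hq h1' h2 a c
  · exact key hq' ht' hp' hq h3 h2' b c
  · exact key ht' hq' hp' ht h3' h1' b a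
  · exact key ht' hq' hp' ht h3' h1' b a

/-- Two large solutions for each root of unity that occurs, and one small solution. -/
theorem numSolutions_le (hr : 6 ≤ r) (hh : 0 < h)
    (hW : (r : ℝ) ^ 13 * (h : ℝ) ^ 6 ≤ d.weight) (Ω : Finset ℂ)
    (hΩ : ∀ p ω w, d.IsRelated h ω p w → ω ∈ Ω) : numSolutions F h ≤ 2 * Ω.card + 1 := by
  set f := fun p : ℤ × ℤ => s(p, -p) with hf
  set A := f '' {p | p ∈ primitiveSolutions F h ∧ 2 * d.size p ^ 2 < d.weight} with hA
  set B : ℂ → Set (Sym2 (ℤ × ℤ)) := fun ω =>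
    f '' {p | d.weight ≤ 2 * d.size p ^ 2 ∧ ∃ w, d.IsRelated h ω p w} with hB
  have hsub : f '' primitiveSolutions F h ⊆ (⋃ ω ∈ Ω, B ω) ∪ A := by
    rintro _ ⟨p, hp, rfl⟩
    rcases lt_or_ge (2 * d.size p ^ 2) d.weight with hs | hs
    · exact Or.inr ⟨p, ⟨hp, hs⟩, rfl⟩
    · left
      obtain ⟨ω, w, hw⟩ := d.exists_isRelated hr hh hW hp hs
      exact Set.mem_biUnion (hΩ p ω w hw) ⟨p, ⟨hs, w, hw⟩, rfl⟩
  have hA1 : A.encard ≤ 1 := by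
    rw [Set.encard_le_one_iff]
    rintro _ _ ⟨p, hp, rfl⟩ ⟨q, hq, rfl⟩
    exact sym2_neg_eq_iff.2 (d.eq_or_eq_neg_of_small hr hh hW hp.1 hq.1 hp.2 hq.2)
  exact (Set.encard_le_encard hsub).trans ((Set.encard_union_le _ _).trans
    (add_le_add (encard_biUnion_le_two_mul Ω B (encard_related_le_two hr hh hW)) hA1))

theorem numSolutions_le_two_mul_add_one (hr : 6 ≤ r) (hh : 0 < h)
    (hW : (r : ℝ) ^ 13 * (h : ℝ) ^ 6 ≤ d.weight) : numSolutions F h ≤ 2 * r + 1 := by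
  have h1 := numSolutions_le hr hh hW (Polynomial.nthRootsFinset r (1 : ℂ)) fun p ω w hw =>
    (Polynomial.mem_nthRootsFinset (by omega) _).2 hw.root
  have hc : (Polynomial.nthRootsFinset r (1 : ℂ)).card ≤ r := by
    rw [(Complex.isPrimitiveRoot_exp r (by omega)).card_nthRootsFinset]
  refine h1.trans ?_
  gcongr

theorem exists_real_tau (hD : 0 < d.b ^ 2 - 4 * d.a * d.c) :
    ∃ t t' : ℝ, d.tau = t ∧ d.tau' = t' := by
  have h1 := d.sqrtDisc_sq
  have h2 : ((d.b ^ 2 - 4 * d.a * d.c : ℤ) : ℂ) =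
      ((√((d.b ^ 2 - 4 * d.a * d.c : ℤ) : ℝ) : ℝ) : ℂ) ^ 2 := by
    rw [← Complex.ofReal_pow, Real.sq_sqrt (by exact_mod_cast hD.le)]
    simp
  rw [h2] at h1
  have hadd := d.tau_add
  have hex : ∃ t : ℝ, d.sqrtDisc = t := by
    rcases sq_eq_sq_iff_eq_or_eq_neg.1 h1 with h | h
    · exact ⟨_, h⟩
    · exact ⟨-√((d.b ^ 2 - 4 * d.a * d.c : ℤ) : ℝ), by rw [h]; push_cast; rfl⟩
  obtain ⟨t, ht⟩ := hex
  rw [sqrtDisc] at ht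
  refine ⟨(d.b + t) / 2, (d.b - t) / 2, ?_, ?_⟩
  · push_cast
    linear_combination (hadd + ht) / 2
  · push_cast
    linear_combination (hadd - ht) / 2

/-- With τ, τ' real, 1 + w = η^r/ξ^r is a quotient of real numbers; it lies within 1/2 of 1, so its
principal root is real. -/
theorem IsRelated.cpow_real (hr : 0 < r) (hD : 0 < d.b ^ 2 - 4 * d.a * d.c) {ω w : ℂ} {p : ℤ × ℤ}
    (hp : d.IsRelated h ω p w) : ∃ t : ℝ, (1 + w) ^ (1 / r : ℂ) = t := by
  obtain ⟨t, t', ht, ht'⟩ := exists_real_tau hD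
  obtain ⟨m, n, h1, h2⟩ := d.conjPair_xi_pow hr p
  have hx := pow_ne_zero r (hp.xi_ne_zero hr.ne')
  have hκ : (r : ℂ) * d.sqrtDisc ≠ 0 := mul_ne_zero (by exact_mod_cast hr.ne') d.sqrtDisc_ne_zero
  have hw : 1 + w = (((m + n * t') / (m + n * t) : ℝ) : ℂ) := by
    push_cast
    rw [← ht, ← ht', ← h1, ← h2, hp.eta_pow, mul_left_comm,
      mul_div_cancel_right₀ _ (mul_ne_zero hκ hx)]
  set y : ℝ := (m + n * t') / (m + n * t)
  have hy : 0 ≤ y := by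
    have h3 := hp.norm_le_half
    rw [show w = ((y - 1 : ℝ) : ℂ) by push_cast; linear_combination hw, Complex.norm_real,
      Real.norm_eq_abs, abs_le] at h3
    linarith
  refine ⟨y ^ (1 / r : ℝ), ?_⟩
  rw [hw, Complex.ofReal_cpow hy]
  push_cast
  rfl

/-- The quotient of ξ(p)η(q) by ξ(q)η(p) is real, and so are both principal roots. Thus ω'/ω is real
of modulus 1. -/
theorem IsRelated.eq_or_eq_neg (hr : 0 < r) (hD : 0 < d.b ^ 2 - 4 * d.a * d.c) {ω ω' w w' : ℂ}
    {p q : ℤ × ℤ} (hp : d.IsRelated h ω p w) (hq : d.IsRelated h ω' q w') : ω' = ω ∨ ω' = -ω := by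
  obtain ⟨t, t', ht, ht'⟩ := exists_real_tau hD
  obtain ⟨y, hy⟩ := hp.cpow_real hr hD
  obtain ⟨y', hy'⟩ := hq.cpow_real hr hD
  obtain ⟨m, n, h1, h2⟩ := d.conjPair_xi_mul_eta p q
  have hx := hp.xi_ne_zero hr.ne'
  have hx' := hq.xi_ne_zero hr.ne'
  have hχ := d.chi_ne_zero
  have n1 := hp.norm_root hr.ne'
  have n2 := hq.norm_root hr.ne'
  have hω : ω ≠ 0 := by rw [← norm_ne_zero_iff, n1]; exact one_ne_zero
  have hω' : ω' ≠ 0 := by rw [← norm_ne_zero_iff, n2]; exact one_ne_zero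
  have hy0 := hp.cpow_ne_zero hr.ne'
  have hy0' := hq.cpow_ne_zero hr.ne'
  rw [hq.eta_eq, hy', ht] at h1
  rw [hp.eta_eq, hy, ht'] at h2
  rw [hy] at hy0
  rw [hy'] at hy0'
  have hk : ω' = (((m + n * t) * y / ((m + n * t') * y') : ℝ) : ℂ) * ω := by
    push_cast
    rw [← h1, ← h2]
    field_simp
  have n3 := congrArg norm hk
  rw [norm_mul, n1, n2, mul_one, Complex.norm_real, Real.norm_eq_abs] at n3
  rcases eq_or_eq_neg_of_abs_eq n3.symm with h3 | h3
  · left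
    rw [hk, h3]
    simp
  · right
    rw [hk, h3]
    simp

theorem numSolutions_le_five (hr : 6 ≤ r) (hh : 0 < h)
    (hW : (r : ℝ) ^ 13 * (h : ℝ) ^ 6 ≤ d.weight) (hD : 0 < d.b ^ 2 - 4 * d.a * d.c) :
    numSolutions F h ≤ 5 := by
  have hex : ∃ Ω : Finset ℂ, Ω.card ≤ 2 ∧ ∀ p ω w, d.IsRelated h ω p w → ω ∈ Ω := by
    by_cases hne : ∃ p ω w, d.IsRelated h ω p w
    · obtain ⟨p, ω, w, hp⟩ := hne
      refine ⟨{ω, -ω}, Finset.card_le_two, fun q ω' w' hq => ?_⟩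
      simpa using hp.eq_or_eq_neg (by omega) hD hq
    · exact ⟨∅, by simp, fun p ω w hp => absurd ⟨p, ω, w, hp⟩ hne⟩
  obtain ⟨Ω, hc, hΩ⟩ := hex
  refine (numSolutions_le hr hh hW Ω hΩ).trans ?_
  have h2 : 2 * Ω.card + 1 ≤ 5 := by omega
  exact_mod_cast h2

theorem numSolutions_le_three (hr : 6 ≤ r) (hodd : Odd r) (hh : 0 < h)
    (hW : (r : ℝ) ^ 13 * (h : ℝ) ^ 6 ≤ d.weight) (hD : 0 < d.b ^ 2 - 4 * d.a * d.c) :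
    numSolutions F h ≤ 3 := by
  have hex : ∃ Ω : Finset ℂ, Ω.card ≤ 1 ∧ ∀ p ω w, d.IsRelated h ω p w → ω ∈ Ω := by
    by_cases hne : ∃ p ω w, d.IsRelated h ω p w
    · obtain ⟨p, ω, w, hp⟩ := hne
      refine ⟨{ω}, by simp, fun q ω' w' hq => ?_⟩
      rcases hp.eq_or_eq_neg (by omega) hD hq with h1 | h1
      · simpa using h1
      -- For odd r, -ω is not an r-th root of unity.
      · have h2 := hq.root
        rw [h1, hodd.neg_pow, hp.root] at h2
        norm_num at h2
    · exact ⟨∅, by simp, fun p ω w hp => absurd ⟨p, ω, w, hp⟩ hne⟩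
  obtain ⟨Ω, hc, hΩ⟩ := hex
  refine (numSolutions_le hr hh hW Ω hΩ).trans ?_
  have h2 : 2 * Ω.card + 1 ≤ 3 := by omega
  exact_mod_cast h2

end Diagonal

end Counting

/-! ### Definite forms. -/

section Definite

theorem IsDefinite.exists_sign {F : MvPolynomial (Fin 2) ℤ} (hF : IsDefinite F) :
    ∃ ε : ℝ, |ε| = 1 ∧ ∀ x y : ℝ, (x, y) ≠ (0, 0) → 0 < ε * MvPolynomial.aeval ![x, y] F := by
  rcases hF with h | h
  · exact ⟨1, by simp, fun x y hxy => by simpa using h x y hxy⟩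
  · exact ⟨-1, by simp, fun x y hxy => by simpa using h x y hxy⟩

namespace Diagonal

variable {r : ℕ} {F : MvPolynomial (Fin 2) ℤ} {d : Diagonal r F} {h : ℤ}

theorem aeval_eq (d : Diagonal r F) (x y : ℝ) : ((MvPolynomial.aeval ![x, y] F : ℝ) : ℂ) =
    (d.α * x + d.β * y) ^ r - (d.γ * x + d.δ * y) ^ r := by
  rw [← eval_map_ofReal, d.isDiag.eval_eq]

/-- For negative discriminant the two forms are α(x + ty) and γ(x + t̄y) with |α| = |γ| and t not
real. A real point with x + ty = μ, where μ² = γ/α, gives both forms the value αμ, so F has a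
nontrivial real zero. -/
theorem disc_pos_of_isDefinite (hr : 0 < r) (hF : IsDefinite F) :
    0 < d.b ^ 2 - 4 * d.a * d.c := by
  by_contra! hle
  have hlt : d.b ^ 2 - 4 * d.a * d.c < 0 := by
    refine lt_of_le_of_ne hle fun h0 => ?_
    have h1 := d.sqrtDisc_sq
    rw [h0, Int.cast_zero] at h1
    exact d.sqrtDisc_ne_zero (pow_eq_zero_iff two_ne_zero |>.1 h1)
  have ha : d.a ≠ 0 := by
    intro h0
    rw [h0] at hlt
    nlinarith [sq_nonneg d.b]
  have haC : (d.a : ℂ) ≠ 0 := by exact_mod_cast ha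
  have hχ := d.chi_ne_zero
  have hαγ : d.α * d.γ ≠ 0 := by rw [d.coeff_sq]; exact mul_ne_zero hχ haC
  have hα : d.α ≠ 0 := left_ne_zero_of_mul hαγ
  have hγ : d.γ ≠ 0 := right_ne_zero_of_mul hαγ
  have hs : starRingEnd ℂ d.sqrtDisc = -d.sqrtDisc := by
    have h1 := d.sqrtDisc_sq
    have h2 : ((d.b ^ 2 - 4 * d.a * d.c : ℤ) : ℂ) =
        (((√(-((d.b ^ 2 - 4 * d.a * d.c : ℤ) : ℝ)) : ℝ) : ℂ) * Complex.I) ^ 2 := by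
      rw [mul_pow, ← Complex.ofReal_pow, Real.sq_sqrt, Complex.I_sq]
      · push_cast
        ring
      · rw [neg_nonneg]
        exact_mod_cast hlt.le
    rw [h2] at h1
    rcases sq_eq_sq_iff_eq_or_eq_neg.1 h1 with h | h <;> rw [h] <;> simp
  have hadd := d.tau_add
  have hτ' : starRingEnd ℂ d.tau' = d.tau := by
    have e : d.tau' = (d.b - d.sqrtDisc) / 2 := by
      rw [sqrtDisc]; linear_combination hadd / 2
    conv_lhs => rw [e]
    rw [map_div₀, map_sub, hs]
    simp only [map_ofNat, map_intCast]
    rw [sqrtDisc]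
    linear_combination -hadd / 2
  -- Complex conjugation exchanges τ and τ', hence the two members of the conjugate pair at the
  -- point (1, 0).
  have hnorm : ‖d.γ‖ = ‖d.α‖ := by
    obtain ⟨m, n, h1, h2⟩ := d.conjPair_xi_pow hr (1, 0)
    have h3 := congrArg (starRingEnd ℂ) h2
    rw [map_add, map_mul _ (n : ℂ), hτ', map_intCast, map_intCast, ← h1] at h3
    have h4 := congrArg norm h3
    rw [Complex.norm_conj, norm_mul, norm_mul _ (d.xi _ ^ r), norm_pow, norm_pow] at h4
    have hκ : ‖(r : ℂ) * d.sqrtDisc‖ ≠ 0 :=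
      norm_ne_zero_iff.2 (mul_ne_zero (by exact_mod_cast hr.ne') d.sqrtDisc_ne_zero)
    have h5 := (pow_left_inj₀ (norm_nonneg _) (norm_nonneg _) hr.ne').1 (mul_left_cancel₀ hκ h4)
    simpa [xi, eta] using h5
  obtain ⟨μ, hμ⟩ : ∃ μ : ℂ, μ ^ 2 = d.γ / d.α :=
    ⟨(d.γ / d.α) ^ (1 / 2 : ℂ), by
      have := Complex.cpow_nat_inv_pow (d.γ / d.α) two_ne_zero
      rw [one_div]
      exact_mod_cast this⟩
  have hμn : ‖μ‖ = 1 := by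
    have h1 := congrArg norm hμ
    rw [norm_pow, norm_div, hnorm, div_self (norm_ne_zero_iff.2 hα)] at h1
    exact (pow_eq_one_iff_of_nonneg (norm_nonneg _) two_ne_zero).1 h1
  have hμμ : μ * starRingEnd ℂ μ = 1 := by
    rw [Complex.mul_conj, Complex.normSq_eq_norm_sq, hμn]
    simp
  set t : ℂ := d.tau' / d.a with ht
  have htc : starRingEnd ℂ t = d.tau / d.a := by
    rw [ht, map_div₀, hτ', map_intCast]
  have htim : t.im ≠ 0 := by
    intro h0
    have h1 := Complex.conj_eq_iff_im.2 h0
    rw [htc, ht, div_left_inj' haC] at h1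
    exact d.sqrtDisc_ne_zero (sub_eq_zero.2 h1)
  set y : ℝ := μ.im / t.im with hy
  set x : ℝ := μ.re - t.re * y with hx
  have hxy : (x : ℂ) + t * y = μ := by
    apply Complex.ext
    · simp [hx]
    · simp [hy]
      field_simp
  have hxy' : (x : ℂ) + starRingEnd ℂ t * y = starRingEnd ℂ μ := by
    rw [← hxy]
    simp
  have hβ : d.β = d.α * t := by
    rw [ht, mul_div_assoc', eq_div_iff haC]
    apply mul_right_cancel₀ hγ
    linear_combination -d.a * d.chi_mul_tau' - d.tau' * d.coeff_sq
  have hδ : d.δ = d.γ * starRingEnd ℂ t := by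
    rw [htc, mul_div_assoc', eq_div_iff haC]
    apply mul_left_cancel₀ hα
    linear_combination -d.a * d.chi_mul_tau - d.tau * d.coeff_sq
  have hzero : MvPolynomial.aeval ![x, y] F = (0 : ℝ) := by
    have h1 := d.aeval_eq x y
    have e1 : d.α * x + d.β * y = d.α * μ := by
      rw [hβ, ← hxy]; ring
    have e2 : d.γ * x + d.δ * y = d.α * μ := by
      have hγ' : d.γ = d.α * μ ^ 2 := by rw [hμ]; field_simp
      calc d.γ * x + d.δ * y = d.γ * (x + starRingEnd ℂ t * y) := by rw [hδ]; ring
        _ = d.α * μ * (μ * starRingEnd ℂ μ) := by rw [hxy', hγ']; ring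
        _ = d.α * μ := by rw [hμμ, mul_one]
    rw [e1, e2, sub_self] at h1
    exact_mod_cast h1
  obtain ⟨ε, -, hε⟩ := hF.exists_sign
  have hne : (x, y) ≠ (0, 0) := by
    intro h0
    rw [Prod.mk.injEq] at h0
    rw [h0.1, h0.2] at hxy
    rw [← hxy] at hμn
    simp at hμn
  have := hε x y hne
  rw [hzero, mul_zero] at this
  exact lt_irrefl _ this

theorem even_of_isDefinite (d : Diagonal r F) (hF : IsDefinite F) : Even r := by
  by_contra hodd
  rw [Nat.not_even_iff_odd] at hodd
  obtain ⟨ε, -, hε⟩ := hF.exists_sign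
  have h1 := hε 1 0 (by simp)
  have h2 := hε (-1) 0 (by simp)
  have h3 : MvPolynomial.aeval ![(-1 : ℝ), 0] F = -MvPolynomial.aeval ![(1 : ℝ), 0] F := by
    have e1 := d.aeval_eq 1 0
    have e2 := d.aeval_eq (-1) 0
    have e3 : ((MvPolynomial.aeval ![(-1 : ℝ), 0] F : ℝ) : ℂ) =
        ((-MvPolynomial.aeval ![(1 : ℝ), 0] F : ℝ) : ℂ) := by
      rw [e2, Complex.ofReal_neg (MvPolynomial.aeval ![(1 : ℝ), 0] F), e1]
      push_cast
      rw [show d.α * -1 + d.β * 0 = -(d.α * 1 + d.β * 0) by ring,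
        show d.γ * -1 + d.δ * 0 = -(d.γ * 1 + d.δ * 0) by ring, hodd.neg_pow, hodd.neg_pow]
      ring
    exact_mod_cast e3
  rw [h3] at h2
  linarith

/-- For positive discriminant both linear forms are proportional to real ones. -/
theorem exists_real_forms (hD : 0 < d.b ^ 2 - 4 * d.a * d.c) :
    (∃ κ : ℂ, ∃ m₁ m₂ : ℝ, d.α = κ * m₁ ∧ d.β = κ * m₂) ∧
      ∃ κ : ℂ, ∃ l₁ l₂ : ℝ, d.γ = κ * l₁ ∧ d.δ = κ * l₂ := by
  obtain ⟨t, t', ht, ht'⟩ := exists_real_tau hD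
  have h1 := d.coeff_sq
  have h2 := d.chi_mul_tau
  have h3 := d.chi_mul_tau'
  have h4 := d.coeff_sq'
  rw [ht] at h2
  rw [ht'] at h3
  have hj := d.det_ne_zero
  rw [det] at hj
  constructor
  -- When γ ≠ 0 the relations αγ = χa and βγ = χτ' allow κ = χ/γ; otherwise δ ≠ 0 and αδ = χτ, βδ =
  -- χc serve.
  · by_cases hγ : d.γ = 0
    · have hδ : d.δ ≠ 0 := fun h0 => hj (by rw [h0, hγ]; ring)
      exact ⟨d.χ / d.δ, t, d.c, by field_simp; linear_combination -h2,
        by push_cast; field_simp; linear_combination h4⟩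
    · exact ⟨d.χ / d.γ, d.a, t', by push_cast; field_simp; linear_combination h1,
        by field_simp; linear_combination -h3⟩
  · by_cases hα : d.α = 0
    · have hβ : d.β ≠ 0 := fun h0 => hj (by rw [h0, hα]; ring)
      exact ⟨d.χ / d.β, t', d.c, by field_simp; linear_combination -h3,
        by push_cast; field_simp; linear_combination h4⟩
    · exact ⟨d.χ / d.α, d.a, t, by push_cast; field_simp; linear_combination h1,
        by field_simp; linear_combination -h2⟩

/-- The values of a definite form dominate the `r`-th powers of its linear forms. -/
theorem norm_pow_le_of_isDefinite (hr : 0 < r) (hF : IsDefinite F) (p : ℤ × ℤ) :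
    ‖d.xi p‖ ^ r ≤ |((MvPolynomial.eval ![p.1, p.2] F : ℤ) : ℝ)| ∧
      ‖d.eta p‖ ^ r ≤ |((MvPolynomial.eval ![p.1, p.2] F : ℤ) : ℝ)| := by
  have hD := d.disc_pos_of_isDefinite hr hF
  have heven := d.even_of_isDefinite hF
  obtain ⟨⟨κ, m₁, m₂, hα, hβ⟩, κ', l₁, l₂, hγ, hδ⟩ := d.exists_real_forms hD
  obtain ⟨ε, hε1, hε⟩ := hF.exists_sign
  have hj := d.det_ne_zero
  rw [det, hα, hβ, hγ, hδ] at hj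
  have hdet : m₁ * l₂ - m₂ * l₁ ≠ 0 := by
    intro h0
    apply hj
    have h0' : (m₁ : ℂ) * l₂ - m₂ * l₁ = 0 := by exact_mod_cast h0
    linear_combination κ * κ' * h0'
  have hval : ∀ x y : ℝ, ((MvPolynomial.aeval ![x, y] F : ℝ) : ℂ) =
      κ ^ r * ((m₁ * x + m₂ * y : ℝ) : ℂ) ^ r - κ' ^ r * ((l₁ * x + l₂ * y : ℝ) : ℂ) ^ r := by
    intro x y
    rw [d.aeval_eq, hα, hβ, hγ, hδ, ← mul_pow, ← mul_pow]
    push_cast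
    ring
  have hr0 := hr.ne'
  have hdr : 0 < (m₁ * l₂ - m₂ * l₁) ^ r := heven.pow_pos hdet
  have hdrC : ((m₁ * l₂ - m₂ * l₁ : ℝ) : ℂ) ^ r ≠ 0 := pow_ne_zero r (by exact_mod_cast hdet)
  -- Evaluating at the zero of the second form isolates κ^r, showing that it is real with the sign
  -- of F. The zero of the first form treats -κ'^r likewise, so F = A·M^r + B·L^r with even r is a
  -- sum of terms of one sign.
  have hA : ∃ A : ℝ, κ ^ r = A ∧ 0 < ε * A := by
    have h1 := hval l₂ (-l₁)
    rw [show l₁ * l₂ + l₂ * -l₁ = 0 by ring, show m₁ * l₂ + m₂ * -l₁ = m₁ * l₂ - m₂ * l₁ by ring,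
      Complex.ofReal_zero, zero_pow hr0, mul_zero, sub_zero] at h1
    have h2 := hε l₂ (-l₁) (by
      intro h0
      rw [Prod.mk.injEq, neg_eq_zero] at h0
      exact hdet (by rw [h0.1, h0.2]; ring))
    refine ⟨MvPolynomial.aeval ![l₂, -l₁] F / (m₁ * l₂ - m₂ * l₁) ^ r, ?_, ?_⟩
    · rw [Complex.ofReal_div, h1, Complex.ofReal_pow]
      field_simp
    · rw [← mul_div_assoc]
      exact div_pos h2 hdr
  have hB : ∃ B : ℝ, -κ' ^ r = B ∧ 0 < ε * B := by
    have h1 := hval m₂ (-m₁)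
    rw [show m₁ * m₂ + m₂ * -m₁ = 0 by ring,
      show l₁ * m₂ + l₂ * -m₁ = -(m₁ * l₂ - m₂ * l₁) by ring,
      Complex.ofReal_zero, zero_pow hr0, mul_zero, zero_sub, Complex.ofReal_neg,
      heven.neg_pow] at h1
    have h2 := hε m₂ (-m₁) (by
      intro h0
      rw [Prod.mk.injEq, neg_eq_zero] at h0
      exact hdet (by rw [h0.1, h0.2]; ring))
    refine ⟨MvPolynomial.aeval ![m₂, -m₁] F / (m₁ * l₂ - m₂ * l₁) ^ r, ?_, ?_⟩
    · rw [Complex.ofReal_div, h1, Complex.ofReal_pow]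
      field_simp
    · rw [← mul_div_assoc]
      exact div_pos h2 hdr
  obtain ⟨A, hA, hA0⟩ := hA
  obtain ⟨B, hB, hB0⟩ := hB
  set M : ℝ := m₁ * p.1 + m₂ * p.2 with hM
  set L : ℝ := l₁ * p.1 + l₂ * p.2 with hL
  have hxi : d.xi p ^ r = ((A * M ^ r : ℝ) : ℂ) := by
    rw [xi, hα, hβ, hM]
    push_cast
    rw [← hA, ← mul_pow]
    congr 1
    ring
  have heta : -d.eta p ^ r = ((B * L ^ r : ℝ) : ℂ) := by
    rw [eta, hγ, hδ, hL]
    push_cast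
    rw [← hB, neg_mul, ← mul_pow]
    congr 2
    ring
  have hF' : ((MvPolynomial.eval ![p.1, p.2] F : ℤ) : ℝ) = A * M ^ r + B * L ^ r := by
    have h1 := d.eval_eq p
    rw [sub_eq_add_neg, hxi, heta] at h1
    exact_mod_cast h1
  have hM0 : 0 ≤ M ^ r := heven.pow_nonneg M
  have hL0 : 0 ≤ L ^ r := heven.pow_nonneg L
  have habs : ∀ z : ℝ, |z| = |ε * z| := fun z => by rw [abs_mul, hε1, one_mul]
  have p1 : 0 ≤ ε * (A * M ^ r) := by rw [← mul_assoc]; positivity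
  have p2 : 0 ≤ ε * (B * L ^ r) := by rw [← mul_assoc]; positivity
  have n1 : ‖d.xi p‖ ^ r = |A * M ^ r| := by
    rw [← norm_pow, hxi, Complex.norm_real, Real.norm_eq_abs]
  have n2 : ‖d.eta p‖ ^ r = |B * L ^ r| := by
    rw [← norm_pow, ← norm_neg, heta, Complex.norm_real, Real.norm_eq_abs]
  rw [n1, n2, hF', habs (A * M ^ r), habs (B * L ^ r), habs (A * M ^ r + B * L ^ r), mul_add,
    abs_of_nonneg p1, abs_of_nonneg p2, abs_of_nonneg (add_nonneg p1 p2)]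
  exact ⟨by linarith, by linarith⟩

/-- All values |ξ|^r, |η|^r are at most h, so two essentially different solutions would force W ≤
h², against r^13 h^6 ≤ W. -/
theorem numSolutions_le_one_of_isDefinite (hr : 6 ≤ r) (hh : 0 < h)
    (hW : (r : ℝ) ^ 13 * (h : ℝ) ^ 6 ≤ d.weight) (hF : IsDefinite F) : numSolutions F h ≤ 1 := by
  refine numSolutions_le_one fun p hp q hq => ?_
  by_contra! hne
  have hh1 : (1 : ℝ) ≤ h := by exact_mod_cast hh
  have hr6 : (6 : ℝ) ≤ r := by exact_mod_cast hr
  have h1 := (d.norm_det_le_of_ne hp hq hne.1 hne.2).trans (norm_sub_le _ _)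
  rw [norm_mul, norm_mul] at h1
  have hle : ∀ p ∈ primitiveSolutions F h, ‖d.xi p‖ ^ r ≤ h ∧ ‖d.eta p‖ ^ r ≤ h := by
    intro p hp
    have h2 := d.norm_pow_le_of_isDefinite (by omega) hF p
    have h3 : |((MvPolynomial.eval ![p.1, p.2] F : ℤ) : ℝ)| ≤ h := by exact_mod_cast hp.2.2
    exact ⟨h2.1.trans h3, h2.2.trans h3⟩
  have key : ∀ p ∈ primitiveSolutions F h, ∀ q ∈ primitiveSolutions F h,
      (‖d.xi p‖ * ‖d.eta q‖) ^ r ≤ (h : ℝ) ^ 2 := by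
    intro p hp q hq
    rw [mul_pow, sq]
    exact mul_le_mul (hle p hp).1 (hle q hq).2 (by positivity) (by linarith)
  have hlt : (h : ℝ) ^ 2 < d.weight := by
    refine lt_of_lt_of_le ?_ hW
    have e1 : (1 : ℝ) < (r : ℝ) ^ 13 := one_lt_pow₀ (by linarith) (by norm_num)
    have e2 : (h : ℝ) ^ 2 ≤ (h : ℝ) ^ 6 := pow_le_pow_right₀ hh1 (by norm_num)
    have e3 : 0 < (h : ℝ) ^ 6 := by positivity
    nlinarith
  rcases half_pow_le_or (norm_nonneg _) h1 r with h2 | h2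
  · exact absurd (h2.trans (key p hp q hq)) (not_le.2 hlt)
  · exact absurd (h2.trans (key q hq p hp)) (not_le.2 hlt)

end Diagonal

end Definite
end DiagForm

/-! ### Assembly of the four bounds. -/

theorem theorem1p3 (r : ℕ) (hr : 6 ≤ r) (F : MvPolynomial (Fin 2) ℤ)
    (hF : DiagForm.IsDiagonalizable r F)
    (Δ : ℂ) (hΔ : DiagForm.IsDiscriminant r F Δ)
    (D : ℤ) (hD : DiagForm.IsQuadraticDiscr r F D)
    (h : ℤ) (hh : 0 < h)
    (hΔ' : (r : ℝ) ^ (13 * (r : ℝ) ^ 2 * ((r : ℝ) - 1) / ((r : ℝ) ^ 2 - 5 * (r : ℝ) - 2)) *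
        (h : ℝ) ^ (4 * ((r : ℝ) - 1) * ((r : ℝ) ^ 2 - (r : ℝ) + 2) /
          ((r : ℝ) ^ 2 - 5 * (r : ℝ) - 2)) ≤ DiagForm.deltaPrime r Δ h) :
    (D < 0 → DiagForm.numSolutions F h ≤ 2 * r + 1) ∧
    (0 < D → Even r → DiagForm.IsIndefinite F → DiagForm.numSolutions F h ≤ 5) ∧
    (0 < D → Odd r → DiagForm.IsIndefinite F → DiagForm.numSolutions F h ≤ 3) ∧
    (DiagForm.IsDefinite F → DiagForm.numSolutions F h ≤ 1) := by
  obtain ⟨d, g, -, rfl⟩ := hD.exists_diagonal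
  have hW : (r : ℝ) ^ 13 * (h : ℝ) ^ 6 ≤ d.weight :=
    DiagForm.pow_le_of_deltaPrime hr hh (norm_nonneg _)
      (d.isDiag.norm_discriminant (by omega) hΔ) hΔ'
  -- The given D differs by a square factor from the discriminant of the primitive triple, so the
  -- sign carries over.
  have hpos : 0 < g ^ 2 * (d.b ^ 2 - 4 * d.a * d.c) → 0 < d.b ^ 2 - 4 * d.a * d.c :=
    fun hD' => by
      by_contra! hle
      exact absurd hD' (not_lt.2 (mul_nonpos_of_nonneg_of_nonpos (sq_nonneg g) hle))
  exact ⟨fun _ => d.numSolutions_le_two_mul_add_one hr hh hW,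
    fun hD' _ _ => d.numSolutions_le_five hr hh hW (hpos hD'),
    fun hD' hodd _ => d.numSolutions_le_three hr hodd hh hW (hpos hD'),
    fun hdef => d.numSolutions_le_one_of_isDefinite hr hh hW hdef⟩
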